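/- Let $n\ge 2$, $1\le k\le n-1$ and $\sigma\in\mathbb{R}$. There is a constant $C_{k,n}=C_{k,n}(\sigma)\ge 0$, depending only on $n$, $k$ and $\sigma$, with the following property. Let $\Omega\subset\mathbb{R}^n$ be an open set (for instance a domain with Lipschitz boundary) and $\mathcal{G}_h$ a subdivision of $\Omega$ by finitely many simplexes: the open simplexes $T\in\mathcal{G}_h$ are pairwise disjoint subsets of $\Omega$, and the closed ones cover exactly $\overline\Omega$. Assume that $\mathcal{G}_h$ is shape regular with constant $\sigma$: every $T\in\mathcal{G}_h$ contains a ball of some radius $r>0$ with $\operatorname{diam}T\le\sigma r$. Let $h=\max_{T\in\mathcal G_h}\operatorname{diam}T$. Notation. Let $\star$ be the Hodge star, $\mathbf d$ the weak exterior derivative and $\boldsymbol\delta_k=(-1)^{kn}\star\mathbf d\star$ on $k$-forms. For an open set $\Xi$, let $H\Lambda^k(\Xi)=\{\omega\in L^2\Lambda^k(\Xi):\mathbf d\omega\in L^2\}$ and $H^*\Lambda^k(\Xi)=\{\omega\in L^2\Lambda^k(\Xi):\boldsymbol\delta_k\omega\in L^2\}$, and let $H_0^*\Lambda^k(\Xi)$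 be the closure of the smooth compactly supported $k$-forms in $H^*\Lambda^k(\Xi)$ for the norm $\|\omega\|_{L^2}+\|\boldsymbol\delta_k\omega\|_{L^2}$. The Koszul operator $\boldsymbol\kappa$ is the contraction with the field $x$, and $\boldsymbol\kappa_T$ the contraction with $\tilde x=x-c_T$, where $c_T$ is the barycentre of $T$. $\mathcal P_0\Lambda^k$ denotes the constant $k$-forms, $$\mathcal P_1^-\Lambda^k=\mathcal P_0\Lambda^k+\boldsymbol\kappa(\mathcal P_0\Lambda^{k+1}),\qquad \mathcal P_1^{*,-}\Lambda^k=\mathcal P_0\Lambda^k+\star\boldsymbol\kappa\star(\mathcal P_0\Lambda^{k-1}).$$ The enriched trimmed space on $T$ is $$\mathbf P(T)=\mathcal P_0\Lambda^k+\boldsymbol\kappa_T(\mathcal P_0\Lambda^{k+1})+\star\boldsymbol\kappa_T\star(\mathcal P_0\Lambda^{k-1})+\mathcal H^2_{\mathbf d}\Lambda^k(T),$$ where $\mathcal H^2_{\mathbf d}\Lambda^k(T)$ is spanned by the forms $\sum_{j\notin\{\alpha_1,\dots,\alpha_k\}}\bigl[(\tilde x^j)^2-\tfrac1{|T|}\int_T(\tilde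 x^j)^2\bigr]\,dx^{\alpha_1}\wedge\dots\wedge dx^{\alpha_k}$, $1\le\alpha_1<\dots<\alpha_k\le n$. Let $\mathbf P(\mathcal G_h)=\prod_{T\in\mathcal G_h}\mathbf P(T)$ be the piecewise space, and let $\mathbf d_h$, $\boldsymbol\delta_{k,h}$ denote $\mathbf d$, $\boldsymbol\delta_k$ applied cell by cell. Interpolator. For $\mu\in H\Lambda^k(T)\cap H^*\Lambda^k(T)$, the interpolant $I_T\mu\in\mathbf P(T)$ is defined by $$\langle\mathbf d I_T\mu,\eta\rangle_{L^2(T)}-\langle I_T\mu,\boldsymbol\delta_{k+1}\eta\rangle_{L^2(T)}=\langle\mathbf d\mu,\eta\rangle_{L^2(T)}-\langle\mu,\boldsymbol\delta_{k+1}\eta\rangle_{L^2(T)}\quad\forall\,\eta\in\mathcal P_1^{*,-}\Lambda^{k+1},$$ $$\langle\boldsymbol\delta_kI_T\mu,\tau\rangle_{L^2(T)}-\langle I_T\mu,\mathbf d\tau\rangle_{L^2(T)}=\langle\boldsymbol\delta_k\mu,\tau\rangle_{L^2(T)}-\langle\mu,\mathbf d\tau\rangle_{L^2(T)}\quad\forall\,\tau\in\mathcal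 P_1^-\Lambda^{k-1},$$ and the global interpolator is given by $(I_h\omega)|_T=I_T(\omega|_T)$ for all $T\in\mathcal G_h$. Claim. For every $\omega\in H\Lambda^k(\Omega)\cap H^*_0\Lambda^k(\Omega)$, on each cell $T$ exactly one $I_T(\omega|_T)\in\mathbf P(T)$ satisfies these two conditions, and $$\|\omega-I_h\omega\|_{L^2}+\|\mathbf d\omega-\mathbf d_hI_h\omega\|_{L^2}+\|\boldsymbol\delta_k\omega-\boldsymbol\delta_{k,h}I_h\omega\|_{L^2}$$ $$\le C_{k,n}\,\max(1,h)\inf_{\mu_h\in\mathbf P(\mathcal G_h)}\Bigl[\|\omega-\mu_h\|_{L^2}+\|\mathbf d_h(\omega-\mu_h)\|_{L^2}+\|\boldsymbol\delta_{k,h}(\omega-\mu_h)\|_{L^2}\Bigr],$$ all norms being $L^2$ norms on $\Omega$. In particular, for mesh size $h\le1$ the factor $\max(1,h)$ is $1$. -/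

import Mathlib

open MeasureTheory
open scoped ENNReal NNReal

noncomputable section

namespace FEForms

/-- Points of `ℝⁿ` with the Euclidean metric. -/
abbrev Pt (n : ℕ) := EuclideanSpace ℝ (Fin n)

/-- Constant-coefficient alternating forms on `ℝⁿ` of all degrees. The coordinate `v I` is the
coefficient of `dx^{i₁} ∧ ⋯ ∧ dx^{iₖ}` where `I = {i₁ < ⋯ < iₖ}`; these basis forms are orthonormal.
A differential form is a function `Pt n → Form n`. -/
abbrev Form (n : ℕ) := EuclideanSpace ℝ (Finset (Fin n))

/-- `Λᵏ`: the forms whose coefficients vanish off the index sets of cardinality `k`. -/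
def Alt (n k : ℕ) : Submodule ℝ (Form n) where
  carrier := {v | ∀ I : Finset (Fin n), I.card ≠ k → v I = 0}
  add_mem' := by
    intro a b ha hb I hI
    simp [ha I hI, hb I hI]
  zero_mem' := by
    intro I _
    simp
  smul_mem' := by
    intro c a ha I hI
    simp [ha I hI]

/-- The sign in `dx^I ∧ dx^J = sgn I J • dx^{I ∪ J}` for disjoint `I` and `J`:
`-1` to the number of pairs that are out of order. -/
def sgn {n : ℕ} (I J : Finset (Fin n)) : ℝ :=
  (-1) ^ ((I ×ˢ J).filter (fun p => p.2 < p.1)).card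

/-- The Hodge star, `⋆ dx^I = sgn I Iᶜ • dx^{Iᶜ}`, i.e. `dx^I ∧ ⋆ dx^I = dx¹ ∧ ⋯ ∧ dxⁿ`. -/
def starVec (n : ℕ) : Form n →ₗ[ℝ] Form n where
  toFun v := WithLp.toLp 2 (fun J => sgn Jᶜ J * v Jᶜ)
  map_add' := by
    intro a b
    ext J
    simp [mul_add]
  map_smul' := by
    intro c a
    ext J
    simp [mul_left_comm]

/-- The Hodge star acting pointwise on differential forms. -/
def hodgeStar {n : ℕ} : (Pt n → Form n) →ₗ[ℝ] (Pt n → Form n) := (starVec n).compLeft (Pt n)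

/-- The Koszul operator with base point `c` (contraction with the field `x - c`):
`κ (dx^{i₁} ∧ ⋯ ∧ dx^{iₖ}) = ∑ⱼ (-1)^{j+1} (x^{iⱼ} - c^{iⱼ}) dx^{i₁} ∧ ⋯ (omit iⱼ) ⋯ ∧ dx^{iₖ}`. -/
def koszul {n : ℕ} (c : Pt n) : (Pt n → Form n) →ₗ[ℝ] (Pt n → Form n) where
  toFun ω := fun x => WithLp.toLp 2
    (fun I => ∑ j ∈ Iᶜ, sgn {j} I * (x j - c j) * ω x (insert j I))
  map_add' := by
    intro a b
    ext x I
    simp [mul_add, Finset.sum_add_distrib]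
  map_smul' := by
    intro r a
    ext x I
    simp [Finset.mul_sum, mul_left_comm]

/-! ### `L²` forms, weak exterior derivative and codifferential on an open set `Ξ` -/

/-- Real-valued test functions: smooth with compact support inside `Ξ`. -/
def IsTest {n : ℕ} (Ξ : Set (Pt n)) (φ : Pt n → ℝ) : Prop :=
  ContDiff ℝ (⊤ : ℕ∞) φ ∧ HasCompactSupport φ ∧ tsupport φ ⊆ Ξ

/-- The partial derivative `∂ⱼ φ`. -/
def pderiv {n : ℕ} (j : Fin n) (φ : Pt n → ℝ) (x : Pt n) : ℝ :=
  fderiv ℝ φ x (EuclideanSpace.single j 1)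

/-- `L²Λᵏ(Ξ)`. -/
def MemL2 {n : ℕ} (k : ℕ) (Ξ : Set (Pt n)) (ω : Pt n → Form n) : Prop :=
  MemLp ω 2 (volume.restrict Ξ) ∧ ∀ᵐ x ∂(volume.restrict Ξ), ω x ∈ Alt n k

/-- The `L²` norm on `Ξ`, with values in `[0, ∞]`. -/
def l2norm {n : ℕ} (Ξ : Set (Pt n)) (ω : Pt n → Form n) : ℝ≥0∞ :=
  eLpNorm ω 2 (volume.restrict Ξ)

/-- The `L²` inner product on `Ξ`. -/
def l2inner {n : ℕ} (Ξ : Set (Pt n)) (ω η : Pt n → Form n) : ℝ :=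
  ∫ x in Ξ, inner ℝ (ω x) (η x)

/-- `dω = η` on `Ξ` in the sense of distributions, where classically
`(dω)_J = ∑_{j ∈ J} sgn {j} (J ∖ j) ∂ⱼ ω_{J ∖ j}`. -/
def IsWeakD {n : ℕ} (Ξ : Set (Pt n)) (ω η : Pt n → Form n) : Prop :=
  ∀ (J : Finset (Fin n)) (φ : Pt n → ℝ), IsTest Ξ φ →
    ∫ x in Ξ, η x J * φ x =
      - ∫ x in Ξ, ∑ j ∈ J, sgn {j} (J.erase j) * ω x (J.erase j) * pderiv j φ x

/-- `HΛᵏ(Ξ)`. -/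
def MemH {n : ℕ} (k : ℕ) (Ξ : Set (Pt n)) (ω : Pt n → Form n) : Prop :=
  MemL2 k Ξ ω ∧ ∃ η, MemL2 (k + 1) Ξ η ∧ IsWeakD Ξ ω η

open Classical in
/-- The square-integrable weak exterior derivative of `ω` on `Ξ` (a representative; it is unique
up to null sets; `0` if there is none). -/
def weakD {n : ℕ} (Ξ : Set (Pt n)) (ω : Pt n → Form n) : Pt n → Form n :=
  if h : ∃ η, MemLp η 2 (volume.restrict Ξ) ∧ IsWeakD Ξ ω η then h.choose else 0

/-- `H*Λᵏ(Ξ)`: the `μ ∈ L²Λᵏ(Ξ)` with `δₖ μ = ± ⋆ d ⋆ μ` in `L²`. -/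
def MemHStar {n : ℕ} (k : ℕ) (Ξ : Set (Pt n)) (μ : Pt n → Form n) : Prop :=
  MemL2 k Ξ μ ∧ MemH (n - k) Ξ (hodgeStar μ)

/-- The codifferential `δₖ μ = (-1)^{kn} ⋆ d ⋆ μ` on `Ξ`, in the weak sense. -/
def codiff {n : ℕ} (k : ℕ) (Ξ : Set (Pt n)) (μ : Pt n → Form n) : Pt n → Form n :=
  ((-1 : ℝ) ^ (k * n)) • hodgeStar (weakD Ξ (hodgeStar μ))

/-- Smooth `k`-forms with compact support in `Ξ`. -/
def IsTestForm {n : ℕ} (k : ℕ) (Ξ : Set (Pt n)) (φ : Pt n → Form n) : Prop :=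
  ContDiff ℝ (⊤ : ℕ∞) φ ∧ HasCompactSupport φ ∧ tsupport φ ⊆ Ξ ∧ ∀ x, φ x ∈ Alt n k

/-- `H*₀Λᵏ(Ξ)`: the closure of the test forms in `H*Λᵏ(Ξ)`. -/
def MemHStarZero {n : ℕ} (k : ℕ) (Ξ : Set (Pt n)) (μ : Pt n → Form n) : Prop :=
  MemHStar k Ξ μ ∧ ∀ ε : ℝ≥0∞, 0 < ε →
    ∃ φ, IsTestForm k Ξ φ ∧ l2norm Ξ (μ - φ) + l2norm Ξ (codiff k Ξ (μ - φ)) < ε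

/-! ### Polynomial spaces on a cell -/

/-- `𝒫₀Λᵏ`: constant `k`-forms. -/
def P0 (n k : ℕ) : Submodule ℝ (Pt n → Form n) :=
  (Alt n k).map (LinearMap.pi (fun _ : Pt n => (LinearMap.id : Form n →ₗ[ℝ] Form n)))

/-- `𝒫₁⁻Λᵏ = 𝒫₀Λᵏ + κ(𝒫₀Λᵏ⁺¹)`. -/
def trimmed (n k : ℕ) : Submodule ℝ (Pt n → Form n) :=
  P0 n k ⊔ (P0 n (k + 1)).map (koszul 0)

/-- `𝒫₁*⁻Λᵏ = 𝒫₀Λᵏ + ⋆κ⋆(𝒫₀Λᵏ⁻¹)` (used for `k ≥ 1`). -/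
def trimmedStar (n k : ℕ) : Submodule ℝ (Pt n → Form n) :=
  P0 n k ⊔ (P0 n (k - 1)).map (hodgeStar ∘ₗ koszul 0 ∘ₗ hodgeStar)

/-- The barycentre `c` of `T`, so that `∫_T (xʲ - cʲ) = 0`. -/
def bary {n : ℕ} (T : Set (Pt n)) : Pt n :=
  WithLp.toLp 2 (fun j => ⨍ x in T, x j)

/-- The form `∑_{j ∉ I} [(xʲ - cʲ)² - mⱼ] dx^I`, where `c` is the barycentre of `T` and `mⱼ` is the
mean of `(xʲ - cʲ)²` over `T`. -/
def bubble {n : ℕ} (T : Set (Pt n)) (I : Finset (Fin n)) : Pt n → Form n := fun x =>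
  EuclideanSpace.single I
    (∑ j ∈ Iᶜ, ((x j - bary T j) ^ 2 - ⨍ y in T, (y j - bary T j) ^ 2))

/-- `ℋ²_d Λᵏ(T)`. -/
def H2d {n : ℕ} (k : ℕ) (T : Set (Pt n)) : Submodule ℝ (Pt n → Form n) :=
  Submodule.span ℝ {μ | ∃ I : Finset (Fin n), I.card = k ∧ μ = bubble T I}

/-- The enriched trimmed space
`𝒫₀Λᵏ + κ_T(𝒫₀Λᵏ⁺¹) + ⋆κ_T⋆(𝒫₀Λᵏ⁻¹) + ℋ²_d Λᵏ(T)` (used for `k ≥ 1`). -/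
def enriched {n : ℕ} (k : ℕ) (T : Set (Pt n)) : Submodule ℝ (Pt n → Form n) :=
  P0 n k ⊔ (P0 n (k + 1)).map (koszul (bary T)) ⊔
    (P0 n (k - 1)).map (hodgeStar ∘ₗ koszul (bary T) ∘ₗ hodgeStar) ⊔ H2d k T

/-! ### The cell-wise interpolator -/

/-- `ν` is the interpolant on the cell `T` of `μ ∈ HΛᵏ(T) ∩ H*Λᵏ(T)` (used for `k ≥ 1`). -/
def IsCellInterpolant {n : ℕ} (k : ℕ) (T : Set (Pt n)) (μ ν : Pt n → Form n) : Prop :=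
  ν ∈ enriched k T ∧
  (∀ η ∈ trimmedStar n (k + 1),
    l2inner T (weakD T ν) η - l2inner T ν (codiff (k + 1) T η) =
      l2inner T (weakD T μ) η - l2inner T μ (codiff (k + 1) T η)) ∧
  (∀ τ ∈ trimmed n (k - 1),
    l2inner T (codiff k T ν) τ - l2inner T ν (weakD T τ) =
      l2inner T (codiff k T μ) τ - l2inner T μ (weakD T τ))

open Classical in
/-- The interpolator on the cell `T` (`0` if there were no interpolant). -/
def cellInterp {n : ℕ} (k : ℕ) (T : Set (Pt n)) (μ : Pt n → Form n) : Pt n → Form n :=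
  if h : ∃ ν, IsCellInterpolant k T μ ν then h.choose else 0

/-! ### Subdivisions and piecewise objects -/

/-- The closed `n`-simplex in `ℝⁿ` with the given affinely independent vertices. -/
def closedCell {n : ℕ} (T : Affine.Simplex ℝ (Pt n) n) : Set (Pt n) :=
  convexHull ℝ (Set.range T.points)

/-- The open `n`-simplex in `ℝⁿ` with the given affinely independent vertices. -/
def cell {n : ℕ} (T : Affine.Simplex ℝ (Pt n) n) : Set (Pt n) :=
  interior (closedCell T)

/-- A subdivision of `Ω` by finitely many simplexes: the open cells are disjoint subsets of `Ω`
and the closed cells cover the closure of `Ω`. No face-to-face condition is imposed. -/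
structure Subdivision {n : ℕ} (Ω : Set (Pt n)) where
  cells : Finset (Affine.Simplex ℝ (Pt n) n)
  cell_subset : ∀ T ∈ cells, cell T ⊆ Ω
  disjoint_cell : ∀ S ∈ cells, ∀ T ∈ cells, S ≠ T → Disjoint (cell S) (cell T)
  closure_eq : closure Ω = ⋃ T ∈ cells, closedCell T

namespace Subdivision

variable {n : ℕ} {Ω : Set (Pt n)}

/-- Shape regularity with constant `σ`: every cell `T` contains a ball of radius `r > 0` with
`diam T ≤ σ r`. -/
def ShapeRegular (G : Subdivision Ω) (σ : ℝ) : Prop :=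
  ∀ T ∈ G.cells, ∃ (c : Pt n) (r : ℝ), 0 < r ∧ Metric.ball c r ⊆ cell T ∧
    Metric.diam (cell T) ≤ σ * r

/-- The mesh size: the largest diameter of a cell. -/
def meshSize (G : Subdivision Ω) : ℝ≥0∞ := ⨆ T ∈ G.cells, Metric.ediam (cell T)

/-- The function on `Ω` that equals `f T` on each open cell `T` (and `0` off the open cells). -/
def glue (G : Subdivision Ω) (f : Affine.Simplex ℝ (Pt n) n → Pt n → Form n) : Pt n → Form n :=
  ∑ T ∈ G.cells, (cell T).indicator (f T)

/-- The global piecewise space: the direct sum of the enriched trimmed spaces over the cells,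
each extended by zero. -/
def enrichedSpace (G : Subdivision Ω) (k : ℕ) : Set (Pt n → Form n) :=
  {μ | ∃ p : Affine.Simplex ℝ (Pt n) n → Pt n → Form n,
    (∀ T ∈ G.cells, p T ∈ enriched k (cell T)) ∧ μ = G.glue p}

/-- The piecewise exterior derivative `d_h`. -/
def dh (G : Subdivision Ω) (μ : Pt n → Form n) : Pt n → Form n :=
  G.glue (fun T => weakD (cell T) μ)

/-- The piecewise codifferential `δ_{k,h}`. -/
def codiffh (G : Subdivision Ω) (k : ℕ) (μ : Pt n → Form n) : Pt n → Form n :=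
  G.glue (fun T => codiff k (cell T) μ)

/-- The global interpolator. -/
def interp (G : Subdivision Ω) (k : ℕ) (μ : Pt n → Form n) : Pt n → Form n :=
  G.glue (fun T => cellInterp k (cell T) μ)

end Subdivision

end FEForms

end

open FEForms

open FEForms

noncomputable section

namespace FEForms

/-! ### Exterior and interior multiplication by coordinate covectors -/

section Algebra

variable {n : ℕ}

/-! The interpolator is local, so the estimate reduces to a bound on each cell `T`, with the
barycentre as origin. Write `k = m + 1` and let x̃ be the position field from the barycentre. An
element of the enriched space is `enr T p q r a`: a constant `p`, the contraction of x̃ with `q`,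
the product x̃ ∧ `r`, and the bubble with coefficients `a`. Its derivative is (k+1)q + 2 x̃ ∧ a
(`weakD_enr`) and its codifferential is ±(n-k+1)r (`codiff_enr`); the bubbles are coclosed because
the coefficient of dx^I involves only the xʲ with j ∉ I.

Constants are L²-orthogonal to forms linear in x̃ and to the mean-free bubbles. Splitting each test
form into its constant part and its linear part therefore turns the interpolation conditions into
the triangular system `CellSystem` (`isCellInterpolant_enr_iff`): `q`, `r` and `p` are each given by
a multiple of the inner product, and `a` then solves an equation whose matrix is the Gram matrix of
a ↦ x̃ ∧ a. For k < n that map is injective on k-forms, whence existence and uniqueness.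

Stability needs a bound on `a` that does not degenerate as the cell shrinks. Two facts give it.
Shape regularity yields diam(T) |T|^{1/2} ‖a‖ ≤ K ‖x̃ ∧ a‖ (`diam_mul_norm_le`). In the equation for
`a`, the form μ occurs only through the difference between the constant `p` and the mean of μ, and
the equation for `p` expresses that difference by the codifferential of μ against the contraction of
x̃, which gains a factor diam(T) (`CellSystem.norm_a_le`). `CellSystem.stability` collects the
bounds.

Since the system is linear and every element of the enriched space is its own interpolant, ω - Iω =
(ω - π) - I(ω - π) for each π in that space, and stability gives quasi-optimality on `T`
(`IsCellInterpolant.quasi_optimal`). The cells fill the domain up to a null set, so squares of L²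
norms add up over the cells. -/

/-- Exterior multiplication `v ↦ dxʲ ∧ v`. -/
def wedge (j : Fin n) : Form n →ₗ[ℝ] Form n where
  toFun v := WithLp.toLp 2 (fun J => if j ∈ J then sgn {j} (J.erase j) * v (J.erase j) else 0)
  map_add' := by
    intro a b
    ext J
    by_cases h : j ∈ J <;> simp [h, mul_add]
  map_smul' := by
    intro c a
    ext J
    by_cases h : j ∈ J <;> simp [h, mul_left_comm]

/-- Contraction with the `j`-th coordinate vector. -/
def contr (j : Fin n) : Form n →ₗ[ℝ] Form n where
  toFun v := WithLp.toLp 2 (fun I => if j ∈ I then 0 else sgn {j} I * v (insert j I))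
  map_add' := by
    intro a b
    ext J
    by_cases h : j ∈ J <;> simp [h, mul_add]
  map_smul' := by
    intro c a
    ext J
    by_cases h : j ∈ J <;> simp [h, mul_left_comm]

theorem wedge_apply (j : Fin n) (v : Form n) (J : Finset (Fin n)) :
    wedge j v J = if j ∈ J then sgn {j} (J.erase j) * v (J.erase j) else 0 := rfl

theorem contr_apply (j : Fin n) (v : Form n) (I : Finset (Fin n)) :
    contr j v I = if j ∈ I then 0 else sgn {j} I * v (insert j I) := rfl

theorem starVec_apply (v : Form n) (J : Finset (Fin n)) :
    starVec n v J = sgn Jᶜ J * v Jᶜ := rfl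

theorem sgn_mul_self (I J : Finset (Fin n)) : sgn I J * sgn I J = 1 := by
  unfold sgn
  rw [← mul_pow]
  norm_num

theorem sgn_union_left {A B : Finset (Fin n)} (h : Disjoint A B) (D : Finset (Fin n)) :
    sgn (A ∪ B) D = sgn A D * sgn B D := by
  unfold sgn
  rw [← pow_add, Finset.union_product, Finset.filter_union, Finset.card_union_of_disjoint]
  refine Finset.disjoint_filter_filter ?_
  rw [Finset.disjoint_left]
  rintro ⟨x, y⟩ hx hy
  exact Finset.disjoint_left.1 h (Finset.mem_product.1 hx).1 (Finset.mem_product.1 hy).1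

theorem sgn_union_right {A B : Finset (Fin n)} (h : Disjoint A B) (D : Finset (Fin n)) :
    sgn D (A ∪ B) = sgn D A * sgn D B := by
  unfold sgn
  rw [← pow_add, Finset.product_union, Finset.filter_union, Finset.card_union_of_disjoint]
  refine Finset.disjoint_filter_filter ?_
  rw [Finset.disjoint_left]
  rintro ⟨x, y⟩ hx hy
  exact Finset.disjoint_left.1 h (Finset.mem_product.1 hx).2 (Finset.mem_product.1 hy).2

/-- Swapping the two factors exchanges in-order and out-of-order pairs; disjointness excludes ties,
so the two exponents add up to the number of all pairs. -/
theorem sgn_mul_sgn_swap {A B : Finset (Fin n)} (h : Disjoint A B) :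
    sgn A B * sgn B A = (-1) ^ (A.card * B.card) := by
  unfold sgn
  have hswap : ((B ×ˢ A).filter (fun p => p.2 < p.1)).card =
      ((A ×ˢ B).filter (fun p => ¬ p.2 < p.1)).card := by
    refine Finset.card_nbij' Prod.swap Prod.swap ?_ ?_ ?_ ?_
    · rintro ⟨x, y⟩ hx
      simp only [Finset.coe_filter, Finset.mem_product, Set.mem_ofPred_eq, Prod.swap] at hx ⊢
      exact ⟨⟨hx.1.2, hx.1.1⟩, not_lt.2 hx.2.le⟩
    · rintro ⟨x, y⟩ hx
      simp only [Finset.coe_filter, Finset.mem_product, Set.mem_ofPred_eq, Prod.swap] at hx ⊢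
      refine ⟨⟨hx.1.2, hx.1.1⟩, lt_of_le_of_ne (not_lt.1 hx.2) ?_⟩
      rintro rfl
      exact Finset.disjoint_left.1 h hx.1.1 hx.1.2
    · intro _ _; simp
    · intro _ _; simp
  rw [hswap, ← pow_add, Finset.card_filter_add_card_filter_not, Finset.card_product]

theorem wedge_wedge (j : Fin n) (v : Form n) : wedge j (wedge j v) = 0 := by
  ext J
  simp [wedge_apply]

theorem contr_contr (j : Fin n) (v : Form n) : contr j (contr j v) = 0 := by
  ext J
  simp [contr_apply]

theorem wedge_contr_apply (j : Fin n) (v : Form n) (J : Finset (Fin n)) :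
    wedge j (contr j v) J = if j ∈ J then v J else 0 := by
  by_cases h : j ∈ J
  · simp [wedge_apply, contr_apply, h, ← mul_assoc, sgn_mul_self]
  · simp [wedge_apply, h]

theorem contr_wedge_apply (j : Fin n) (v : Form n) (J : Finset (Fin n)) :
    contr j (wedge j v) J = if j ∈ J then 0 else v J := by
  by_cases h : j ∈ J
  · simp [contr_apply, h]
  · simp [wedge_apply, contr_apply, h, ← mul_assoc, sgn_mul_self]

theorem wedge_contr_wedge (j : Fin n) (v : Form n) : wedge j (contr j (wedge j v)) = wedge j v := by
  ext J
  rw [wedge_contr_apply]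
  by_cases h : j ∈ J <;> simp [wedge_apply, h]

/-- Adjointness comes from the bijection `J ↦ J.erase j` between index sets containing `j` and those
avoiding it; both operators carry the same sign there. -/
theorem inner_wedge_left (j : Fin n) (u v : Form n) :
    inner ℝ (wedge j u) v = inner ℝ u (contr j v) := by
  simp only [PiLp.inner_apply, wedge_apply, contr_apply, RCLike.inner_apply, conj_trivial]
  simp only [mul_ite, mul_zero, ite_mul, zero_mul]
  rw [← Finset.sum_filter, Finset.sum_ite, Finset.sum_const_zero, zero_add]
  refine Finset.sum_nbij' (fun J => J.erase j) (fun I => insert j I) ?_ ?_ ?_ ?_ ?_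
  · intro J hJ; simp
  · intro J hJ; simp
  · intro J hJ; simp only [Finset.mem_filter, Finset.mem_univ, true_and] at hJ; simp [hJ]
  · intro J hJ; simp only [Finset.mem_filter, Finset.mem_univ, true_and] at hJ; simp [hJ]
  · intro J hJ
    simp only [Finset.mem_filter, Finset.mem_univ, true_and] at hJ
    simp [hJ]; ring

theorem norm_contr_wedge_le (j : Fin n) (v : Form n) : ‖contr j (wedge j v)‖ ≤ ‖v‖ := by
  rw [EuclideanSpace.norm_eq, EuclideanSpace.norm_eq]
  refine Real.sqrt_le_sqrt (Finset.sum_le_sum fun J _ => ?_)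
  rw [contr_wedge_apply]
  split_ifs
  · simpa using sq_nonneg (v J)
  · exact le_rfl

theorem norm_wedge_le (j : Fin n) (v : Form n) : ‖wedge j v‖ ≤ ‖v‖ := by
  have h : ‖wedge j v‖ ^ 2 ≤ ‖v‖ ^ 2 := by
    rw [← real_inner_self_eq_norm_sq, inner_wedge_left]
    calc _ ≤ ‖v‖ * ‖contr j (wedge j v)‖ := real_inner_le_norm _ _
      _ ≤ ‖v‖ * ‖v‖ := by gcongr; exact norm_contr_wedge_le j v
      _ = _ := by ring
  exact le_of_sq_le_sq h (norm_nonneg _)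

theorem norm_contr_le (j : Fin n) (v : Form n) : ‖contr j v‖ ≤ ‖v‖ := by
  rcases eq_or_lt_of_le (norm_nonneg (contr j v)) with h | h
  · rw [← h]; exact norm_nonneg _
  · have h2 : ‖contr j v‖ * ‖contr j v‖ ≤ ‖contr j v‖ * ‖v‖ := by
      rw [← real_inner_self_eq_norm_mul_norm, ← inner_wedge_left]
      calc _ ≤ ‖wedge j (contr j v)‖ * ‖v‖ := real_inner_le_norm _ _
        _ ≤ _ := by gcongr; exact norm_wedge_le _ _
    exact le_of_mul_le_mul_left h2 h

theorem wedge_mem {k : ℕ} {v : Form n} (hv : v ∈ Alt n k) (j : Fin n) :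
    wedge j v ∈ Alt n (k + 1) := by
  intro J hJ
  rw [wedge_apply]
  split_ifs with h
  · rw [hv, mul_zero]
    have := Finset.card_erase_add_one h
    omega
  · rfl

theorem contr_mem {k : ℕ} {v : Form n} (hv : v ∈ Alt n (k + 1)) (j : Fin n) :
    contr j v ∈ Alt n k := by
  intro J hJ
  rw [contr_apply]
  split_ifs with h
  · rfl
  · rw [hv, mul_zero]
    rw [Finset.card_insert_of_notMem h]
    omega

theorem contr_wedge_mem {k : ℕ} {v : Form n} (hv : v ∈ Alt n k) (j : Fin n) :
    contr j (wedge j v) ∈ Alt n k := contr_mem (wedge_mem hv j) j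

/-- The `j`-th summand is the projection onto the index sets containing `j`, so a set of cardinality
`k` is counted `k` times. In `sum_contr_wedge` it is counted by the `n - k` indices outside it. -/
theorem sum_wedge_contr {k : ℕ} {v : Form n} (hv : v ∈ Alt n k) :
    ∑ j, wedge j (contr j v) = (k : ℝ) • v := by
  ext J
  rw [WithLp.ofLp_sum, Finset.sum_apply]
  simp only [wedge_contr_apply, PiLp.smul_apply, smul_eq_mul]
  rw [← Finset.sum_filter, Finset.sum_const]
  by_cases h : J.card = k
  · simp [h]
  · simp [hv J h]

theorem sum_contr_wedge {k : ℕ} {v : Form n} (hv : v ∈ Alt n k) :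
    ∑ j, contr j (wedge j v) = ((n : ℝ) - k) • v := by
  ext J
  rw [WithLp.ofLp_sum, Finset.sum_apply]
  simp only [contr_wedge_apply, PiLp.smul_apply, smul_eq_mul]
  by_cases h : J.card = k
  · have h1 : ∀ j : Fin n, (if j ∈ J then (0 : ℝ) else v J) = v J - if j ∈ J then v J else 0 := by
      intro j; split_ifs <;> simp
    simp only [h1, Finset.sum_sub_distrib]
    rw [← Finset.sum_filter (s := Finset.univ) (p := fun j => j ∈ J), Finset.sum_const,
      Finset.sum_const]
    simp [h]; ring
  · simp [hv J h]

theorem compl_erase_eq {I : Finset (Fin n)} {j : Fin n} : (Iᶜ.erase j)ᶜ = insert j I := by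
  ext x; simp only [Finset.mem_compl, Finset.mem_erase, Finset.mem_insert]; tauto

theorem exists_star_wedge_star (n k : ℕ) : ∃ s : ℝ, s * s = 1 ∧
    ∀ (j : Fin n) (v : Form n), v ∈ Alt n k →
      starVec n (wedge j (starVec n v)) = s • contr j v := by
  -- After the squared signs of `{j}` against the other sets cancel, what remains is the sign of
  -- swapping `I` (of size `k - 1`) with `B` (of size `n - k`).
  refine ⟨(-1) ^ ((k - 1) * (n - k)), by rw [← mul_pow]; norm_num, fun j v hv => ?_⟩
  ext I
  rw [starVec_apply, wedge_apply, PiLp.smul_apply, contr_apply, smul_eq_mul]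
  by_cases h : j ∈ I
  · simp [h]
  · rw [if_pos (by simpa using h), if_neg h, starVec_apply, compl_erase_eq]
    by_cases hk : (insert j I).card = k
    · have hd : Disjoint {j} I := by simpa using h
      have hB : Iᶜ = {j} ∪ Iᶜ.erase j := by
        ext x; simp only [Finset.mem_compl, Finset.mem_erase, Finset.mem_union, Finset.mem_singleton]
        by_cases hx : x = j
        · subst hx; simp [h]
        · simp [hx]
      set B := Iᶜ.erase j with hBdef
      have hdB : Disjoint {j} B := by simp [hBdef]
      have hIB : Disjoint I B := by
        rw [Finset.disjoint_left]; intro x hx hx'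
        simp [hBdef, hx] at hx'
      have e1 : sgn Iᶜ I = sgn {j} I * sgn B I := by rw [hB, sgn_union_left hdB]
      have e2 : sgn (insert j I) B = sgn {j} B * sgn I B := by
        rw [Finset.insert_eq, sgn_union_left hd]
      have e3 := sgn_mul_sgn_swap hIB
      rw [Finset.card_insert_of_notMem h] at hk
      have hc : B.card = n - k := by
        have h1 : Iᶜ.card = B.card + 1 := (Finset.card_erase_add_one (by simpa using h)).symm
        have h2 := Finset.card_add_card_compl I
        rw [Fintype.card_fin] at h2
        omega
      rw [e1, e2]
      have h5 : I.card = k - 1 := by omega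
      rw [h5, hc] at e3
      rw [← e3]
      linear_combination (sgn {j} I * sgn B I * sgn I B * v (insert j I)) * sgn_mul_self {j} B
    · rw [hv _ hk]; ring

theorem exists_star_contr_star (n k : ℕ) : ∃ s : ℝ, s * s = 1 ∧
    ∀ (j : Fin n) (v : Form n), v ∈ Alt n k →
      starVec n (contr j (starVec n v)) = s • wedge j v := by
  -- The three factors swap `A = J.erase j` with `B = Jᶜ`, `j` with `A`, and `j` with `B`; here `A`
  -- has `k` elements and `B` has `n - k - 1`.
  refine ⟨(-1) ^ (k * (n - k - 1)) * (-1) ^ k * (-1) ^ (n - k - 1), ?_, fun j v hv => ?_⟩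
  · have h : ∀ m : ℕ, ((-1 : ℝ) ^ m) * (-1) ^ m = 1 := fun m => by rw [← mul_pow]; norm_num
    calc _ = ((-1 : ℝ) ^ (k * (n - k - 1)) * (-1) ^ (k * (n - k - 1))) * ((-1) ^ k * (-1) ^ k) *
          ((-1) ^ (n - k - 1) * (-1) ^ (n - k - 1)) := by ring
      _ = 1 := by rw [h, h, h]; norm_num
  ext J
  rw [starVec_apply, contr_apply, PiLp.smul_apply, wedge_apply, smul_eq_mul]
  by_cases h : j ∈ J
  · rw [if_neg (by simpa using h), if_pos h, starVec_apply]
    have e0 : (insert j Jᶜ)ᶜ = J.erase j := by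
      ext x; simp only [Finset.mem_compl, Finset.mem_erase, Finset.mem_insert]; tauto
    rw [e0]
    by_cases hk : (J.erase j).card = k
    · set A := J.erase j with hA
      have hJ : J = {j} ∪ A := by rw [← Finset.insert_eq, hA, Finset.insert_erase h]
      have hdA : Disjoint {j} A := by simp [hA]
      set B := Jᶜ with hB
      have hjB : Disjoint {j} B := by simpa [hB] using h
      have hAB : Disjoint A B := by
        rw [Finset.disjoint_left]; intro x hx hx'
        simp only [hA, hB, Finset.mem_erase, Finset.mem_compl] at hx hx'
        exact hx' hx.2
      have e1 : sgn B J = sgn B {j} * sgn B A := by rw [hJ, sgn_union_right hdA]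
      have e2 : sgn A (insert j B) = sgn A {j} * sgn A B := by
        rw [Finset.insert_eq, sgn_union_right hjB]
      have e3 := sgn_mul_sgn_swap hAB
      have e4 := sgn_mul_sgn_swap hdA
      have e5 := sgn_mul_sgn_swap hjB
      have hc : B.card = n - k - 1 := by
        have h1 : J.card = A.card + 1 := (Finset.card_erase_add_one h).symm
        have h2 := Finset.card_add_card_compl J
        rw [Fintype.card_fin, ← hB] at h2
        omega
      rw [hk, hc] at e3
      rw [hk, Finset.card_singleton, one_mul] at e4
      rw [hc, Finset.card_singleton, one_mul] at e5
      rw [e1, e2, ← e3, ← e4, ← e5]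
      linear_combination (-sgn B {j} * sgn B A * sgn A {j} * sgn A B * sgn {j} B * v A) *
        sgn_mul_self {j} A
    · rw [hv _ hk]; ring
  · simp [h]

theorem koszul_apply (c : Pt n) (ω : Pt n → Form n) (x : Pt n) :
    koszul c ω x = ∑ j, (x j - c j) • contr j (ω x) := by
  ext I
  rw [WithLp.ofLp_sum, Finset.sum_apply]
  simp only [PiLp.smul_apply, contr_apply, smul_eq_mul, mul_ite, mul_zero]
  rw [Finset.sum_ite, Finset.sum_const_zero, zero_add]
  change ∑ j ∈ Iᶜ, sgn {j} I * (x j - c j) * ω x (insert j I) = _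
  refine Finset.sum_congr ?_ fun j _ => by ring
  ext j; simp

end Algebra

/-! ### Calculus of the weak exterior derivative -/

section WeakDerivative

variable {n : ℕ} {Ξ T : Set (Pt n)}

theorem IsTest.mono {φ : Pt n → ℝ} (h : IsTest T φ) (hT : T ⊆ Ξ) : IsTest Ξ φ :=
  ⟨h.1, h.2.1, h.2.2.trans hT⟩

theorem IsTest.eq_zero {φ : Pt n → ℝ} (h : IsTest Ξ φ) {x : Pt n} (hx : x ∉ Ξ) : φ x = 0 :=
  image_eq_zero_of_notMem_tsupport fun h' => hx (h.2.2 h')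

theorem IsTest.pderiv_eq_zero {φ : Pt n → ℝ} (h : IsTest Ξ φ) (j : Fin n) {x : Pt n}
    (hx : x ∉ Ξ) : pderiv j φ x = 0 := by
  have : fderiv ℝ φ x = 0 :=
    image_eq_zero_of_notMem_tsupport fun h' => hx (h.2.2 (tsupport_fderiv_subset ℝ h'))
  simp [pderiv, this]

theorem IsTest.continuous_pderiv {φ : Pt n → ℝ} (h : IsTest Ξ φ) (j : Fin n) :
    Continuous (pderiv j φ) :=
  (h.1.continuous_fderiv (by simp)).clm_apply continuous_const

theorem IsTest.hasCompactSupport_pderiv {φ : Pt n → ℝ} (h : IsTest Ξ φ) (j : Fin n) :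
    HasCompactSupport (pderiv j φ) :=
  h.2.1.fderiv_apply ℝ (EuclideanSpace.single j 1)

/-- Only the test function needs compact support: both integrands vanish off `Ξ`, so the integrals
extend to the whole space and there is no boundary term. -/
theorem setIntegral_pderiv_mul {f φ : Pt n → ℝ} (hf : ContDiff ℝ 1 f) (hφ : IsTest Ξ φ)
    (j : Fin n) : ∫ x in Ξ, pderiv j f x * φ x = - ∫ x in Ξ, f x * pderiv j φ x := by
  rw [setIntegral_eq_integral_of_forall_compl_eq_zero
      (fun x hx => by rw [hφ.eq_zero hx, mul_zero]),
    setIntegral_eq_integral_of_forall_compl_eq_zero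
      (fun x hx => by rw [hφ.pderiv_eq_zero j hx, mul_zero])]
  have hc : Continuous (pderiv j f) := (hf.continuous_fderiv (by simp)).clm_apply continuous_const
  have h := integral_mul_fderiv_eq_neg_fderiv_mul_of_integrable (μ := volume) (f := f) (g := φ)
    (v := EuclideanSpace.single j (1 : ℝ))
    ((hc.mul hφ.1.continuous).integrable_of_hasCompactSupport hφ.2.1.mul_left)
    ((hf.continuous.mul (hφ.continuous_pderiv j)).integrable_of_hasCompactSupport
      (hφ.hasCompactSupport_pderiv j).mul_left)
    ((hf.continuous.mul hφ.1.continuous).integrable_of_hasCompactSupport hφ.2.1.mul_left)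
    (fun x _ => hf.differentiable (by simp) x) (fun x _ => hφ.1.differentiable (by simp) x)
  simp only [pderiv]
  linarith

theorem _root_.MeasureTheory.MemLp.form_coord {μ : Measure (Pt n)} {ω : Pt n → Form n}
    {p : ℝ≥0∞} (h : MemLp ω p μ) (J : Finset (Fin n)) : MemLp (fun x => ω x J) p μ :=
  (EuclideanSpace.proj (𝕜 := ℝ) J).comp_memLp' h

theorem integrable_coord_mul {ω : Pt n → Form n} (h : MemLp ω 2 (volume.restrict Ξ))
    (J : Finset (Fin n)) {ψ : Pt n → ℝ} (hc : Continuous ψ) (hs : HasCompactSupport ψ) :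
    Integrable (fun x => ω x J * ψ x) (volume.restrict Ξ) :=
  (h.form_coord J).integrable_mul (q := 2) (hc.memLp_of_hasCompactSupport hs)

theorem integrable_sum_coord_mul {ω : Pt n → Form n} (h : MemLp ω 2 (volume.restrict Ξ))
    (J : Finset (Fin n)) {φ : Pt n → ℝ} (hφ : IsTest Ξ φ) :
    Integrable (fun x => ∑ j ∈ J, sgn {j} (J.erase j) * ω x (J.erase j) * pderiv j φ x)
      (volume.restrict Ξ) := by
  refine integrable_finsetSum _ fun j _ => ?_
  simp only [mul_assoc]
  exact (integrable_coord_mul h _ (hφ.continuous_pderiv j)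
    (hφ.hasCompactSupport_pderiv j)).const_mul _

theorem IsWeakD.sub {ω₁ ω₂ η₁ η₂ : Pt n → Form n}
    (hω₁ : MemLp ω₁ 2 (volume.restrict Ξ)) (hω₂ : MemLp ω₂ 2 (volume.restrict Ξ))
    (hη₁ : MemLp η₁ 2 (volume.restrict Ξ)) (hη₂ : MemLp η₂ 2 (volume.restrict Ξ))
    (h₁ : IsWeakD Ξ ω₁ η₁) (h₂ : IsWeakD Ξ ω₂ η₂) : IsWeakD Ξ (ω₁ - ω₂) (η₁ - η₂) := by
  intro J φ hφ
  have e1 := integral_sub (integrable_coord_mul hη₁ J hφ.1.continuous hφ.2.1)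
    (integrable_coord_mul hη₂ J hφ.1.continuous hφ.2.1)
  have e2 := integral_sub (integrable_sum_coord_mul hω₁ J hφ) (integrable_sum_coord_mul hω₂ J hφ)
  rw [h₁ J φ hφ, h₂ J φ hφ] at e1
  simp only [Pi.sub_apply, PiLp.sub_apply, sub_mul, mul_sub, Finset.sum_sub_distrib]
  rw [e1, e2]
  ring

/-- The fundamental lemma of the calculus of variations, applied to each coefficient. It makes the
chosen representative `weakD` computable almost everywhere. -/
theorem IsWeakD.ae_eq (hΞ : IsOpen Ξ) {ω η₁ η₂ : Pt n → Form n}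
    (hη₁ : MemLp η₁ 2 (volume.restrict Ξ)) (hη₂ : MemLp η₂ 2 (volume.restrict Ξ))
    (h₁ : IsWeakD Ξ ω η₁) (h₂ : IsWeakD Ξ ω η₂) : η₁ =ᵐ[volume.restrict Ξ] η₂ := by
  have key : ∀ J : Finset (Fin n), ∀ᵐ x ∂(volume.restrict Ξ), η₁ x J - η₂ x J = 0 := by
    intro J
    rw [ae_restrict_iff' hΞ.measurableSet]
    have hm : MemLp (fun x => η₁ x J - η₂ x J) 2 (volume.restrict Ξ) :=
      (hη₁.form_coord J).sub (hη₂.form_coord J)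
    refine hΞ.ae_eq_zero_of_integral_contDiff_smul_eq_zero ?_ fun φ hφ hφc hφs => ?_
    · exact (locallyIntegrableOn_of_locallyIntegrable_restrict
        (hm.locallyIntegrable (by norm_num)))
    · have hφ' : IsTest Ξ φ := ⟨hφ, hφc, hφs⟩
      have e1 := integral_sub (integrable_coord_mul hη₁ J hφ'.1.continuous hφ'.2.1)
        (integrable_coord_mul hη₂ J hφ'.1.continuous hφ'.2.1)
      rw [h₁ J φ hφ', h₂ J φ hφ', sub_self] at e1
      rw [← setIntegral_eq_integral_of_forall_compl_eq_zero (s := Ξ)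
        (fun x hx => by rw [hφ'.eq_zero hx, zero_smul]), ← e1]
      refine integral_congr_ae (Filter.Eventually.of_forall fun x => ?_)
      simp only [smul_eq_mul]
      ring
  filter_upwards [ae_all_iff.2 key] with x hx
  ext J
  exact sub_eq_zero.1 (hx J)

theorem IsWeakD.mono (hΞ : IsOpen Ξ) (hTΞ : T ⊆ Ξ) {ω η : Pt n → Form n}
    (h : IsWeakD Ξ ω η) : IsWeakD T ω η := by
  intro J φ hφ
  have := h J φ (hφ.mono hTΞ)
  rw [setIntegral_eq_of_subset_of_forall_sdiff_eq_zero hΞ.measurableSet hTΞ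
      (fun x hx => by rw [hφ.eq_zero hx.2, mul_zero]),
    setIntegral_eq_of_subset_of_forall_sdiff_eq_zero hΞ.measurableSet hTΞ
      (fun x hx => Finset.sum_eq_zero fun j _ => by
        rw [hφ.pderiv_eq_zero j hx.2, mul_zero])] at this
  exact this

/-- `ω` has a square-integrable weak exterior derivative on `Ξ`. -/
def HasWeakD (Ξ : Set (Pt n)) (ω : Pt n → Form n) : Prop :=
  ∃ η, MemLp η 2 (volume.restrict Ξ) ∧ IsWeakD Ξ ω η

theorem HasWeakD.memLp {ω : Pt n → Form n} (h : HasWeakD Ξ ω) :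
    MemLp (weakD Ξ ω) 2 (volume.restrict Ξ) := by
  have h' : ∃ η, MemLp η 2 (volume.restrict Ξ) ∧ IsWeakD Ξ ω η := h
  rw [weakD, dif_pos h']
  exact h'.choose_spec.1

theorem HasWeakD.isWeakD {ω : Pt n → Form n} (h : HasWeakD Ξ ω) : IsWeakD Ξ ω (weakD Ξ ω) := by
  have h' : ∃ η, MemLp η 2 (volume.restrict Ξ) ∧ IsWeakD Ξ ω η := h
  rw [weakD, dif_pos h']
  exact h'.choose_spec.2

theorem IsWeakD.weakD_ae_eq (hΞ : IsOpen Ξ) {ω η : Pt n → Form n}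
    (hη : MemLp η 2 (volume.restrict Ξ)) (h : IsWeakD Ξ ω η) :
    weakD Ξ ω =ᵐ[volume.restrict Ξ] η :=
  have hw : HasWeakD Ξ ω := ⟨η, hη, h⟩
  IsWeakD.ae_eq hΞ hw.memLp hη hw.isWeakD h

/-- An exact equality, not merely almost everywhere: the two forms satisfy the same defining
predicate, so the choice in `weakD` is the same. Hence on a cell a glued form can be replaced by its
local piece. -/
theorem weakD_congr (hΞ : IsOpen Ξ) {ω₁ ω₂ : Pt n → Form n} (h : Set.EqOn ω₁ ω₂ Ξ) :
    weakD Ξ ω₁ = weakD Ξ ω₂ := by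
  have : IsWeakD Ξ ω₁ = IsWeakD Ξ ω₂ := by
    funext η
    refine propext (forall_congr' fun J => forall_congr' fun φ => forall_congr' fun _ => ?_)
    rw [setIntegral_congr_fun (f := fun x => ∑ j ∈ J, sgn {j} (J.erase j) * ω₁ x (J.erase j) *
      pderiv j φ x) (g := fun x => ∑ j ∈ J, sgn {j} (J.erase j) * ω₂ x (J.erase j) *
      pderiv j φ x) hΞ.measurableSet fun x hx => by simp only [h hx]]
  unfold weakD
  generalize IsWeakD Ξ ω₁ = P at this
  subst this
  rfl

theorem codiff_congr (hΞ : IsOpen Ξ) (k : ℕ) {ω₁ ω₂ : Pt n → Form n} (h : Set.EqOn ω₁ ω₂ Ξ) :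
    codiff k Ξ ω₁ = codiff k Ξ ω₂ := by
  have : Set.EqOn (hodgeStar ω₁) (hodgeStar ω₂) Ξ := fun x hx => congrArg (starVec n) (h hx)
  rw [codiff, codiff, weakD_congr hΞ this]

theorem hodgeStar_apply (ω : Pt n → Form n) (x : Pt n) : hodgeStar ω x = starVec n (ω x) := rfl

theorem _root_.MeasureTheory.MemLp.hodgeStar {μ : Measure (Pt n)} {ω : Pt n → Form n}
    {p : ℝ≥0∞} (h : MemLp ω p μ) : MemLp (hodgeStar ω) p μ := by
  have hs := (starVec n).toContinuousLinearMap.comp_memLp' h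
  exact hs

/-- `ω` has square-integrable weak exterior derivative and codifferential on `Ξ`. -/
structure Admissible (Ξ : Set (Pt n)) (ω : Pt n → Form n) : Prop where
  memLp : MemLp ω 2 (volume.restrict Ξ)
  hasWeakD : HasWeakD Ξ ω
  hasWeakD_star : HasWeakD Ξ (hodgeStar ω)

theorem codiff_apply (k : ℕ) (ω : Pt n → Form n) (x : Pt n) :
    codiff k Ξ ω x = (-1 : ℝ) ^ (k * n) • starVec n (weakD Ξ (hodgeStar ω) x) := rfl

theorem Admissible.memLp_codiff {ω : Pt n → Form n} (h : Admissible Ξ ω) (k : ℕ) :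
    MemLp (codiff k Ξ ω) 2 (volume.restrict Ξ) :=
  h.hasWeakD_star.memLp.hodgeStar.const_smul _

theorem Admissible.sub {ω₁ ω₂ : Pt n → Form n} (h₁ : Admissible Ξ ω₁) (h₂ : Admissible Ξ ω₂) :
    Admissible Ξ (ω₁ - ω₂) := by
  refine ⟨h₁.memLp.sub h₂.memLp, ⟨_, h₁.hasWeakD.memLp.sub h₂.hasWeakD.memLp,
    h₁.hasWeakD.isWeakD.sub h₁.memLp h₂.memLp h₁.hasWeakD.memLp h₂.hasWeakD.memLp
      h₂.hasWeakD.isWeakD⟩, ?_⟩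
  rw [map_sub]
  exact ⟨_, h₁.hasWeakD_star.memLp.sub h₂.hasWeakD_star.memLp,
    h₁.hasWeakD_star.isWeakD.sub h₁.memLp.hodgeStar h₂.memLp.hodgeStar h₁.hasWeakD_star.memLp
      h₂.hasWeakD_star.memLp h₂.hasWeakD_star.isWeakD⟩

theorem Admissible.weakD_sub (hΞ : IsOpen Ξ) {ω₁ ω₂ : Pt n → Form n} (h₁ : Admissible Ξ ω₁)
    (h₂ : Admissible Ξ ω₂) :
    weakD Ξ (ω₁ - ω₂) =ᵐ[volume.restrict Ξ] weakD Ξ ω₁ - weakD Ξ ω₂ :=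
  (h₁.hasWeakD.isWeakD.sub h₁.memLp h₂.memLp h₁.hasWeakD.memLp h₂.hasWeakD.memLp
    h₂.hasWeakD.isWeakD).weakD_ae_eq hΞ (h₁.hasWeakD.memLp.sub h₂.hasWeakD.memLp)

theorem Admissible.codiff_sub (hΞ : IsOpen Ξ) (k : ℕ) {ω₁ ω₂ : Pt n → Form n}
    (h₁ : Admissible Ξ ω₁) (h₂ : Admissible Ξ ω₂) :
    codiff k Ξ (ω₁ - ω₂) =ᵐ[volume.restrict Ξ] codiff k Ξ ω₁ - codiff k Ξ ω₂ := by
  have h : weakD Ξ (hodgeStar (ω₁ - ω₂)) =ᵐ[volume.restrict Ξ]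
      weakD Ξ (hodgeStar ω₁) - weakD Ξ (hodgeStar ω₂) := by
    rw [map_sub]
    exact (h₁.hasWeakD_star.isWeakD.sub h₁.memLp.hodgeStar h₂.memLp.hodgeStar
      h₁.hasWeakD_star.memLp h₂.hasWeakD_star.memLp h₂.hasWeakD_star.isWeakD).weakD_ae_eq hΞ
      (h₁.hasWeakD_star.memLp.sub h₂.hasWeakD_star.memLp)
  filter_upwards [h] with x hx
  rw [codiff_apply, hx, Pi.sub_apply, Pi.sub_apply, map_sub, smul_sub, codiff_apply, codiff_apply]

theorem Admissible.mono (hΞ : IsOpen Ξ) (hTΞ : T ⊆ Ξ) {ω : Pt n → Form n}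
    (h : Admissible Ξ ω) : Admissible T ω :=
  have hm := Measure.restrict_mono_set volume hTΞ
  ⟨h.memLp.mono_measure hm,
    ⟨_, h.hasWeakD.memLp.mono_measure hm, h.hasWeakD.isWeakD.mono hΞ hTΞ⟩,
    ⟨_, h.hasWeakD_star.memLp.mono_measure hm, h.hasWeakD_star.isWeakD.mono hΞ hTΞ⟩⟩

theorem Admissible.weakD_mono (hΞ : IsOpen Ξ) (hT : IsOpen T) (hTΞ : T ⊆ Ξ) {ω : Pt n → Form n}
    (h : Admissible Ξ ω) : weakD T ω =ᵐ[volume.restrict T] weakD Ξ ω :=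
  (h.hasWeakD.isWeakD.mono hΞ hTΞ).weakD_ae_eq hT
    (h.hasWeakD.memLp.mono_measure (Measure.restrict_mono_set volume hTΞ))

theorem Admissible.codiff_mono (hΞ : IsOpen Ξ) (hT : IsOpen T) (hTΞ : T ⊆ Ξ) (k : ℕ)
    {ω : Pt n → Form n} (h : Admissible Ξ ω) :
    codiff k T ω =ᵐ[volume.restrict T] codiff k Ξ ω := by
  filter_upwards [(h.hasWeakD_star.isWeakD.mono hΞ hTΞ).weakD_ae_eq hT
    (h.hasWeakD_star.memLp.mono_measure (Measure.restrict_mono_set volume hTΞ))] with x hx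
  simp only [codiff_apply, hx]

/-! ### Forms with diagonal quadratic coefficients -/

/-- The form `p + ∑ⱼ (xʲ - cʲ) Aⱼ + ∑ⱼ (xʲ - cʲ)² Bⱼ`. -/
def quad (c : Pt n) (p : Form n) (A B : Fin n → Form n) : Pt n → Form n := fun x =>
  p + ∑ j, (x j - c j) • A j + ∑ j, (x j - c j) ^ 2 • B j

/-- The `j`-th partial derivative of `quad c p A B`. -/
def quadDeriv (c : Pt n) (A B : Fin n → Form n) (j : Fin n) (x : Pt n) : Form n :=
  A j + (2 * (x j - c j)) • B j

theorem contDiff_quad (c : Pt n) (p : Form n) (A B : Fin n → Form n) :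
    ContDiff ℝ 1 (quad c p A B) := by
  unfold quad
  fun_prop

theorem pderiv_quad (c : Pt n) (p : Form n) (A B : Fin n → Form n) (j : Fin n)
    (J : Finset (Fin n)) (x : Pt n) :
    pderiv j (fun x => quad c p A B x J) x = quadDeriv c A B j x J := by
  have hx : ∀ i : Fin n, HasFDerivAt (fun x : Pt n => x i - c i)
      (EuclideanSpace.proj (𝕜 := ℝ) i : Pt n →L[ℝ] ℝ) x := fun i =>
    ((EuclideanSpace.proj (𝕜 := ℝ) i : Pt n →L[ℝ] ℝ).hasFDerivAt).sub_const (c i)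
  have h := ((HasFDerivAt.fun_sum (u := Finset.univ) fun i _ => (hx i).mul_const (A i J)).add
    (HasFDerivAt.fun_sum (u := Finset.univ) fun i _ => ((hx i).pow 2).mul_const (B i J))).const_add
      (p J)
  have e : (fun x => quad c p A B x J) = fun x : Pt n => p J + (∑ i, (x i - c i) * A i J +
      ∑ i, (x i - c i) ^ 2 * B i J) := by
    funext y
    simp [quad, add_assoc]
  rw [pderiv, e]
  erw [h.fderiv]
  simp [quadDeriv]
  ring

/-- The classical derivative is the weak one, by integration by parts. Quadratic terms without mixed
products suffice for the enriched space and for both test spaces. -/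
theorem isWeakD_quad (c : Pt n) (p : Form n) (A B : Fin n → Form n) :
    IsWeakD Ξ (quad c p A B) (fun x => ∑ j, wedge j (quadDeriv c A B j x)) := by
  intro J φ hφ
  have hcd : ∀ I : Finset (Fin n), ContDiff ℝ 1 (fun x => quad c p A B x I) := fun I =>
    ((EuclideanSpace.proj (𝕜 := ℝ) I : Form n →L[ℝ] ℝ).contDiff).comp (contDiff_quad c p A B)
  have e : ∀ x, (∑ j, wedge j (quadDeriv c A B j x)) J * φ x =
      ∑ j ∈ J, sgn {j} (J.erase j) *
        (pderiv j (fun x => quad c p A B x (J.erase j)) x * φ x) := by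
    intro x
    rw [WithLp.ofLp_sum, Finset.sum_apply, Finset.sum_mul]
    simp only [wedge_apply, ite_mul, zero_mul, pderiv_quad]
    rw [← Finset.sum_filter]
    simp only [Finset.filter_mem_eq_inter, Finset.univ_inter, mul_assoc]
  simp only [e, mul_assoc]
  have hcp : ∀ (I : Finset (Fin n)) (j : Fin n), Continuous (pderiv j fun x => quad c p A B x I) :=
    fun I j => ((hcd I).continuous_fderiv (by simp)).clm_apply continuous_const
  rw [integral_finsetSum _ fun j _ => ?_, integral_finsetSum _ fun j _ => ?_]
  · simp only [integral_const_mul]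
    rw [← Finset.sum_neg_distrib]
    refine Finset.sum_congr rfl fun j _ => ?_
    rw [setIntegral_pderiv_mul (hcd _) hφ, mul_neg]
  · exact ((((hcd _).continuous.mul (hφ.continuous_pderiv j)).integrable_of_hasCompactSupport
      (hφ.hasCompactSupport_pderiv j).mul_left).integrableOn).const_mul _
  · exact ((((hcp _ j).mul hφ.1.continuous).integrable_of_hasCompactSupport
      hφ.2.1.mul_left).integrableOn).const_mul _

theorem memLp_of_continuous (hT : Bornology.IsBounded T) {ω : Pt n → Form n} (h : Continuous ω) :
    MemLp ω 2 (volume.restrict T) := by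
  have hc := hT.isCompact_closure
  obtain ⟨M, hM⟩ := hc.exists_bound_of_continuousOn h.continuousOn
  have : IsFiniteMeasure (volume.restrict (closure T)) :=
    ⟨by rw [Measure.restrict_apply_univ]; exact hc.measure_lt_top⟩
  have : MemLp ω 2 (volume.restrict (closure T)) :=
    MemLp.of_bound h.aestronglyMeasurable M
      ((ae_restrict_iff' isClosed_closure.measurableSet).2 (Filter.Eventually.of_forall hM))
  exact this.mono_measure (Measure.restrict_mono_set _ subset_closure)

theorem continuous_quad (c : Pt n) (p : Form n) (A B : Fin n → Form n) :
    Continuous (quad c p A B) := (contDiff_quad c p A B).continuous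

theorem continuous_sum_quadDeriv (L : Fin n → Form n →ₗ[ℝ] Form n) (c : Pt n)
    (A B : Fin n → Form n) : Continuous (fun x => ∑ j, L j (quadDeriv c A B j x)) := by
  refine continuous_finsetSum _ fun j _ => (L j).continuous_of_finiteDimensional.comp ?_
  unfold quadDeriv
  fun_prop

theorem weakD_quad (hT : IsOpen T) (hb : Bornology.IsBounded T) (c : Pt n) (p : Form n)
    (A B : Fin n → Form n) : weakD T (quad c p A B) =ᵐ[volume.restrict T]
      fun x => ∑ j, wedge j (quadDeriv c A B j x) :=
  (isWeakD_quad c p A B).weakD_ae_eq hT (memLp_of_continuous hb (continuous_sum_quadDeriv _ c A B))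

theorem hodgeStar_quad (c : Pt n) (p : Form n) (A B : Fin n → Form n) :
    hodgeStar (quad c p A B) =
      quad c (starVec n p) (fun j => starVec n (A j)) (fun j => starVec n (B j)) := by
  funext x
  simp [hodgeStar_apply, quad]

theorem admissible_quad (hb : Bornology.IsBounded T) (c : Pt n) (p : Form n)
    (A B : Fin n → Form n) : Admissible T (quad c p A B) := by
  refine ⟨memLp_of_continuous hb (continuous_quad c p A B),
    ⟨_, memLp_of_continuous hb (continuous_sum_quadDeriv _ c A B), isWeakD_quad c p A B⟩, ?_⟩
  rw [hodgeStar_quad]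
  exact ⟨_, memLp_of_continuous hb (continuous_sum_quadDeriv _ c _ _), isWeakD_quad c _ _ _⟩

/-- Conjugation by the star turns every `wedge j` into `contr j` up to one sign depending only on
`n` and `k`. The sign is quantified before the cell and the coefficients so that it can be fixed
once; apart from squaring to 1 its value is irrelevant. -/
theorem exists_codiff_quad (n k : ℕ) : ∃ s : ℝ, s * s = 1 ∧
    ∀ (T : Set (Pt n)), IsOpen T → Bornology.IsBounded T →
    ∀ (c : Pt n) (p : Form n) (A B : Fin n → Form n), (∀ j, A j ∈ Alt n k) → (∀ j, B j ∈ Alt n k) →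
      codiff k T (quad c p A B) =ᵐ[volume.restrict T]
        fun x => s • ∑ j, contr j (quadDeriv c A B j x) := by
  obtain ⟨s, hs, h⟩ := exists_star_wedge_star n k
  have h1 : ((-1 : ℝ) ^ (k * n)) * (-1) ^ (k * n) = 1 := by rw [← mul_pow]; norm_num
  refine ⟨(-1) ^ (k * n) * s, by linear_combination s * s * h1 + hs, ?_⟩
  intro T hT hb c p A B hA hB
  have hd := weakD_quad hT hb c (starVec n p) (fun j => starVec n (A j)) (fun j => starVec n (B j))
  filter_upwards [hd] with x hx
  rw [codiff_apply, hodgeStar_quad, hx, map_sum, mul_smul]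
  refine congrArg _ ?_
  rw [Finset.smul_sum]
  refine Finset.sum_congr rfl fun j _ => ?_
  have e : quadDeriv c (fun j => starVec n (A j)) (fun j => starVec n (B j)) j x =
      starVec n (quadDeriv c A B j x) := by simp [quadDeriv]
  rw [e, h]
  exact (Alt n k).add_mem (hA j) ((Alt n k).smul_mem _ (hB j))

end WeakDerivative

/-! ### The enriched space in coordinates -/

section CellSpaces

variable {n : ℕ} {T : Set (Pt n)}

/-- The constant form with value `v`, as a linear map. -/
def constL (n : ℕ) : Form n →ₗ[ℝ] (Pt n → Form n) :=
  LinearMap.pi (fun _ : Pt n => (LinearMap.id : Form n →ₗ[ℝ] Form n))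

/-- The linear form `∑ⱼ (xʲ - bʲ) Lⱼ v`, as a linear map in `v`. -/
def linL (b : Pt n) (L : Fin n → Form n →ₗ[ℝ] Form n) : Form n →ₗ[ℝ] (Pt n → Form n) :=
  LinearMap.pi (fun x => ∑ j, (x j - b j) • L j)

/-- The mean of `(xʲ - bʲ)²` over `T`, where `b` is the barycentre of `T`. -/
def secondMoment (T : Set (Pt n)) (j : Fin n) : ℝ := ⨍ y in T, (y j - bary T j) ^ 2

/-- The bubble form with coefficients `a`. -/
def bubbleL (T : Set (Pt n)) : Form n →ₗ[ℝ] (Pt n → Form n) :=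
  LinearMap.pi (fun x => ∑ j, ((x j - bary T j) ^ 2 - secondMoment T j) • (contr j ∘ₗ wedge j))

/-- The element of the enriched space with coefficients `p`, `q`, `r`, `a`. -/
def enr (T : Set (Pt n)) (p q r a : Form n) : Pt n → Form n :=
  constL n p + linL (bary T) contr q + linL (bary T) wedge r + bubbleL T a

theorem constL_apply (v : Form n) (x : Pt n) : constL n v x = v := rfl

theorem linL_apply (b : Pt n) (L : Fin n → Form n →ₗ[ℝ] Form n) (v : Form n) (x : Pt n) :
    linL b L v x = ∑ j, (x j - b j) • L j v := by
  simp [linL, LinearMap.sum_apply]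

theorem bubbleL_apply (a : Form n) (x : Pt n) : bubbleL T a x =
    ∑ j, ((x j - bary T j) ^ 2 - secondMoment T j) • contr j (wedge j a) := by
  simp [bubbleL, LinearMap.sum_apply]

theorem mem_P0 {k : ℕ} {η : Pt n → Form n} : η ∈ P0 n k ↔ ∃ v ∈ Alt n k, constL n v = η :=
  Submodule.mem_map

theorem linL_eq_add (b : Pt n) (L : Fin n → Form n →ₗ[ℝ] Form n) (v : Form n) :
    linL 0 L v = linL b L v + constL n (∑ j, b j • L j v) := by
  funext x
  simp only [linL_apply, Pi.add_apply, constL_apply, sub_smul, Finset.sum_sub_distrib]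
  simp

theorem koszul_constL (b : Pt n) (v : Form n) : koszul b (constL n v) = linL b contr v := by
  funext x
  rw [koszul_apply, linL_apply]
  rfl

theorem exists_star_koszul_star (n k : ℕ) : ∃ s : ℝ, s * s = 1 ∧
    ∀ (b : Pt n) (v : Form n), v ∈ Alt n k →
      hodgeStar (koszul b (hodgeStar (constL n v))) = s • linL b wedge v := by
  obtain ⟨s, hs, h⟩ := exists_star_contr_star n k
  refine ⟨s, hs, fun b v hv => ?_⟩
  funext x
  rw [hodgeStar_apply, koszul_apply, Pi.smul_apply, linL_apply, map_sum, Finset.smul_sum]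
  refine Finset.sum_congr rfl fun j _ => ?_
  rw [map_smul, hodgeStar_apply, constL_apply, h j v hv, smul_comm]

theorem mem_map_koszul {k : ℕ} {b : Pt n} {η : Pt n → Form n} :
    η ∈ (P0 n k).map (koszul b) ↔ ∃ v ∈ Alt n k, linL b contr v = η := by
  simp only [Submodule.mem_map, mem_P0]
  constructor
  · rintro ⟨_, ⟨v, hv, rfl⟩, rfl⟩
    exact ⟨v, hv, (koszul_constL b v).symm⟩
  · rintro ⟨v, hv, rfl⟩
    exact ⟨_, ⟨v, hv, rfl⟩, koszul_constL b v⟩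

theorem mem_map_star_koszul_star {k : ℕ} {b : Pt n} {η : Pt n → Form n} :
    η ∈ (P0 n k).map (hodgeStar ∘ₗ koszul b ∘ₗ hodgeStar) ↔
      ∃ v ∈ Alt n k, linL b wedge v = η := by
  obtain ⟨s, hs, h⟩ := exists_star_koszul_star n k
  simp only [Submodule.mem_map, mem_P0, LinearMap.comp_apply]
  constructor
  · rintro ⟨_, ⟨v, hv, rfl⟩, rfl⟩
    exact ⟨s • v, (Alt n k).smul_mem s hv, by rw [h b v hv, map_smul]⟩
  · rintro ⟨v, hv, rfl⟩
    refine ⟨_, ⟨s • v, (Alt n k).smul_mem s hv, rfl⟩, ?_⟩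
    rw [h b _ ((Alt n k).smul_mem s hv), map_smul, smul_smul, hs, one_smul]

/-- `contr j ∘ wedge j` is the projection onto index sets avoiding `j`, which produces exactly the
restriction j ∉ I in the bubble. -/
theorem bubble_eq (T : Set (Pt n)) (I : Finset (Fin n)) :
    bubble T I = bubbleL T (EuclideanSpace.single I 1) := by
  funext x
  ext J
  rw [bubbleL_apply, WithLp.ofLp_sum, Finset.sum_apply]
  simp only [PiLp.smul_apply, contr_wedge_apply, smul_eq_mul, bubble, PiLp.single_apply]
  by_cases h : J = I
  · subst h
    simp only [if_true, mul_ite, mul_zero, mul_one]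
    rw [Finset.sum_ite, Finset.sum_const_zero, zero_add]
    refine Finset.sum_congr ?_ fun j _ => rfl
    ext j; simp
  · simp [h]

theorem mem_H2d {k : ℕ} {η : Pt n → Form n} : η ∈ H2d k T ↔ ∃ a ∈ Alt n k, bubbleL T a = η := by
  rw [← Submodule.mem_map]
  suffices h : H2d k T = (Alt n k).map (bubbleL T) by rw [h]
  refine le_antisymm (Submodule.span_le.2 ?_) ?_
  · rintro _ ⟨I, hI, rfl⟩
    refine ⟨EuclideanSpace.single I 1, fun J hJ => ?_, (bubble_eq T I).symm⟩
    rw [PiLp.single_apply, if_neg]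
    rintro rfl
    exact hJ hI
  · rintro _ ⟨a, ha, rfl⟩
    have e : a = ∑ I, a I • EuclideanSpace.single I (1 : ℝ) := by
      ext J
      rw [WithLp.ofLp_sum, Finset.sum_apply]
      simp [PiLp.single_apply]
    rw [e, map_sum]
    refine Submodule.sum_mem _ fun I _ => ?_
    rw [map_smul, ← bubble_eq]
    by_cases hI : I.card = k
    · exact Submodule.smul_mem _ _ (Submodule.subset_span ⟨I, hI, rfl⟩)
    · rw [ha I hI, zero_smul]
      exact Submodule.zero_mem _

theorem mem_enriched {k : ℕ} {ν : Pt n → Form n} : ν ∈ enriched k T ↔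
    ∃ p ∈ Alt n k, ∃ q ∈ Alt n (k + 1), ∃ r ∈ Alt n (k - 1), ∃ a ∈ Alt n k, ν = enr T p q r a := by
  simp only [enriched, Submodule.mem_sup, mem_P0, mem_map_koszul, mem_map_star_koszul_star, mem_H2d]
  constructor
  · rintro ⟨_, ⟨_, ⟨_, ⟨p, hp, rfl⟩, _, ⟨q, hq, rfl⟩, rfl⟩, _, ⟨r, hr, rfl⟩, rfl⟩, _,
      ⟨a, ha, rfl⟩, rfl⟩
    exact ⟨p, hp, q, hq, r, hr, a, ha, rfl⟩
  · rintro ⟨p, hp, q, hq, r, hr, a, ha, rfl⟩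
    exact ⟨_, ⟨_, ⟨_, ⟨p, hp, rfl⟩, _, ⟨q, hq, rfl⟩, rfl⟩, _, ⟨r, hr, rfl⟩, rfl⟩, _,
      ⟨a, ha, rfl⟩, rfl⟩

theorem sum_smul_mem {k l : ℕ} {L : Fin n → Form n →ₗ[ℝ] Form n}
    (hL : ∀ j, ∀ v ∈ Alt n k, L j v ∈ Alt n l) (b : Pt n) {v : Form n} (hv : v ∈ Alt n k) :
    ∑ j, b j • L j v ∈ Alt n l :=
  Submodule.sum_mem _ fun j _ => Submodule.smul_mem _ _ (hL j v hv)

/-- Moving the base point of a linear form changes it by a constant, and the constants are in the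
space. The test spaces, defined with base point 0, can thus be recentred at the barycentre. -/
theorem mem_sup_linL {k l : ℕ} {L : Fin n → Form n →ₗ[ℝ] Form n}
    (hL : ∀ j, ∀ v ∈ Alt n k, L j v ∈ Alt n l) (b : Pt n) {η : Pt n → Form n} :
    (∃ y, (∃ v ∈ Alt n l, constL n v = y) ∧ ∃ z, (∃ v ∈ Alt n k, linL 0 L v = z) ∧ y + z = η) ↔
      ∃ e ∈ Alt n l, ∃ c ∈ Alt n k, η = constL n e + linL b L c := by
  constructor
  · rintro ⟨_, ⟨e, he, rfl⟩, _, ⟨c, hc, rfl⟩, rfl⟩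
    refine ⟨e + ∑ j, b j • L j c, Submodule.add_mem _ he (sum_smul_mem hL b hc), c, hc, ?_⟩
    rw [linL_eq_add b, map_add]
    abel
  · rintro ⟨e, he, c, hc, rfl⟩
    refine ⟨_, ⟨e - ∑ j, b j • L j c, Submodule.sub_mem _ he (sum_smul_mem hL b hc), rfl⟩, _,
      ⟨c, hc, rfl⟩, ?_⟩
    rw [linL_eq_add b, map_sub]
    abel

theorem mem_trimmedStar {k : ℕ} (b : Pt n) {η : Pt n → Form n} : η ∈ trimmedStar n (k + 1) ↔
    ∃ e ∈ Alt n (k + 1), ∃ c ∈ Alt n k, η = constL n e + linL b wedge c := by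
  simp only [trimmedStar, Submodule.mem_sup, mem_P0, mem_map_star_koszul_star, Nat.add_sub_cancel]
  exact mem_sup_linL (fun j v hv => wedge_mem hv j) b

theorem mem_trimmed {k : ℕ} (b : Pt n) {τ : Pt n → Form n} : τ ∈ trimmed n k ↔
    ∃ e ∈ Alt n k, ∃ c ∈ Alt n (k + 1), τ = constL n e + linL b contr c := by
  simp only [trimmed, Submodule.mem_sup, mem_P0, mem_map_koszul]
  exact mem_sup_linL (fun j v hv => contr_mem hv j) b

theorem constL_add_linL_eq_quad (b : Pt n) (L : Fin n → Form n →ₗ[ℝ] Form n) (e c : Form n) :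
    constL n e + linL b L c = quad b e (fun j => L j c) 0 := by
  funext x
  simp [quad, linL_apply, constL_apply]

theorem enr_eq_quad (p q r a : Form n) : enr T p q r a =
    quad (bary T) (p - ∑ j, secondMoment T j • contr j (wedge j a))
      (fun j => contr j q + wedge j r) (fun j => contr j (wedge j a)) := by
  funext x
  simp only [enr, quad, Pi.add_apply, linL_apply, bubbleL_apply, constL_apply, sub_smul, smul_add,
    Finset.sum_add_distrib, Finset.sum_sub_distrib]
  abel

theorem enr_sub (p q r a p' q' r' a' : Form n) :
    enr T p q r a - enr T p' q' r' a' = enr T (p - p') (q - q') (r - r') (a - a') := by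
  simp only [enr, map_sub]
  abel

theorem continuous_enr (p q r a : Form n) : Continuous (enr T p q r a) := by
  rw [enr_eq_quad]
  exact continuous_quad _ _ _ _

theorem continuous_constL (v : Form n) : Continuous (constL n v) := continuous_const

theorem continuous_linL (b : Pt n) (L : Fin n → Form n →ₗ[ℝ] Form n) (v : Form n) :
    Continuous (linL b L v) := by
  have := continuous_quad b 0 (fun j => L j v) 0
  rw [← constL_add_linL_eq_quad, map_zero, zero_add] at this
  exact this

theorem admissible_enr (hb : Bornology.IsBounded T) (p q r a : Form n) :
    Admissible T (enr T p q r a) := by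
  rw [enr_eq_quad]
  exact admissible_quad hb _ _ _ _

/-- Contraction with x̃ contributes `k + 1` copies of `q`; the `r` term is closed since `wedge j`
squares to zero; the bubble gives 2 x̃ ∧ a because `wedge j ∘ contr j ∘ wedge j = wedge j`. -/
theorem weakD_enr (hT : IsOpen T) (hb : Bornology.IsBounded T) {k : ℕ} (p r a : Form n)
    {q : Form n} (hq : q ∈ Alt n (k + 1)) : weakD T (enr T p q r a) =ᵐ[volume.restrict T]
      constL n (((k : ℝ) + 1) • q) + (2 : ℝ) • linL (bary T) wedge a := by
  rw [enr_eq_quad]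
  refine (weakD_quad hT hb _ _ _ _).trans (Filter.Eventually.of_forall fun x => ?_)
  have h := sum_wedge_contr hq
  push_cast at h
  simp only [quadDeriv, map_add, map_smul, wedge_contr_wedge, wedge_wedge, Finset.sum_add_distrib,
    Pi.add_apply, Pi.smul_apply, constL_apply, linL_apply, h, Finset.smul_sum, mul_smul]
  simp

/-- The sign by which `codiff k` differs from `∑ⱼ contr j ∘ ∂ⱼ` on `k`-forms. -/
def codiffSign (n k : ℕ) : ℝ := (exists_codiff_quad n k).choose

theorem codiffSign_mul_self (n k : ℕ) : codiffSign n k * codiffSign n k = 1 :=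
  (exists_codiff_quad n k).choose_spec.1

theorem codiff_quad (hT : IsOpen T) (hb : Bornology.IsBounded T) {k : ℕ} (c : Pt n) (p : Form n)
    {A B : Fin n → Form n} (hA : ∀ j, A j ∈ Alt n k) (hB : ∀ j, B j ∈ Alt n k) :
    codiff k T (quad c p A B) =ᵐ[volume.restrict T]
      fun x => codiffSign n k • ∑ j, contr j (quadDeriv c A B j x) :=
  (exists_codiff_quad n k).choose_spec.2 T hT hb c p A B hA hB

/-- Since `contr j` squares to zero, both the `q` term and the bubble are coclosed, and only `r`
survives. -/
theorem codiff_enr (hT : IsOpen T) (hb : Bornology.IsBounded T) {k : ℕ} (p : Form n)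
    {q r a : Form n} (hq : q ∈ Alt n (k + 2)) (hr : r ∈ Alt n k) (ha : a ∈ Alt n (k + 1)) :
    codiff (k + 1) T (enr T p q r a) =ᵐ[volume.restrict T]
      constL n ((codiffSign n (k + 1) * (n - k)) • r) := by
  rw [enr_eq_quad]
  refine (codiff_quad hT hb _ _ (fun j => Submodule.add_mem _ (contr_mem hq j) (wedge_mem hr j))
    (fun j => contr_wedge_mem ha j)).trans (Filter.Eventually.of_forall fun x => ?_)
  simp only [quadDeriv, map_add, map_smul, contr_contr, Finset.sum_add_distrib,
    constL_apply, sum_contr_wedge hr, mul_smul]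
  simp

theorem codiff_testStar (hT : IsOpen T) (hb : Bornology.IsBounded T) {k : ℕ} (b : Pt n)
    (e : Form n) {c : Form n} (hc : c ∈ Alt n k) :
    codiff (k + 1) T (constL n e + linL b wedge c) =ᵐ[volume.restrict T]
      constL n ((codiffSign n (k + 1) * (n - k)) • c) := by
  rw [constL_add_linL_eq_quad]
  refine (codiff_quad hT hb _ _ (fun j => wedge_mem hc j) (fun j => Submodule.zero_mem _)).trans
    (Filter.Eventually.of_forall fun x => ?_)
  simp [quadDeriv, constL_apply, sum_contr_wedge hc, mul_smul]

theorem weakD_test (hT : IsOpen T) (hb : Bornology.IsBounded T) {k : ℕ} (b : Pt n)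
    (e : Form n) {c : Form n} (hc : c ∈ Alt n k) :
    weakD T (constL n e + linL b contr c) =ᵐ[volume.restrict T] constL n ((k : ℝ) • c) := by
  rw [constL_add_linL_eq_quad]
  refine (weakD_quad hT hb _ _ _ _).trans (Filter.Eventually.of_forall fun x => ?_)
  simp [quadDeriv, constL_apply, sum_wedge_contr hc]

end CellSpaces

/-! ### The `L²` inner product on a cell -/

section InnerProduct

variable {n : ℕ} {T : Set (Pt n)}

/-- Passage to the Hilbert space `Lp`, from which the Cauchy–Schwarz inequality is inherited. -/
theorem l2inner_eq_inner_toLp {f g : Pt n → Form n} (hf : MemLp f 2 (volume.restrict T))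
    (hg : MemLp g 2 (volume.restrict T)) : l2inner T f g = inner ℝ (hf.toLp f) (hg.toLp g) := by
  rw [L2.inner_def]
  refine integral_congr_ae ?_
  filter_upwards [hf.coeFn_toLp, hg.coeFn_toLp] with x h1 h2
  rw [h1, h2]

theorem integrable_inner {f g : Pt n → Form n} (hf : MemLp f 2 (volume.restrict T))
    (hg : MemLp g 2 (volume.restrict T)) :
    Integrable (fun x => inner ℝ (f x) (g x)) (volume.restrict T) := by
  refine (L2.integrable_inner (𝕜 := ℝ) (hf.toLp f) (hg.toLp g)).congr ?_
  filter_upwards [hf.coeFn_toLp, hg.coeFn_toLp] with x h1 h2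
  rw [h1, h2]

theorem abs_l2inner_le {f g : Pt n → Form n} (hf : MemLp f 2 (volume.restrict T))
    (hg : MemLp g 2 (volume.restrict T)) :
    |l2inner T f g| ≤ (l2norm T f).toReal * (l2norm T g).toReal := by
  rw [l2inner_eq_inner_toLp hf hg, l2norm, l2norm, ← Lp.norm_toLp f hf, ← Lp.norm_toLp g hg]
  exact abs_real_inner_le_norm _ _

theorem l2inner_self {f : Pt n → Form n} (hf : MemLp f 2 (volume.restrict T)) :
    l2inner T f f = (l2norm T f).toReal ^ 2 := by
  rw [l2inner_eq_inner_toLp hf hf, l2norm, ← Lp.norm_toLp f hf, real_inner_self_eq_norm_sq]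

theorem l2inner_congr {f f' g g' : Pt n → Form n} (hf : f =ᵐ[volume.restrict T] f')
    (hg : g =ᵐ[volume.restrict T] g') : l2inner T f g = l2inner T f' g' := by
  refine integral_congr_ae ?_
  filter_upwards [hf, hg] with x h1 h2
  rw [h1, h2]

theorem l2inner_comm (f g : Pt n → Form n) : l2inner T f g = l2inner T g f := by
  simp only [l2inner, real_inner_comm]

theorem l2inner_add_left {f f' g : Pt n → Form n} (hf : MemLp f 2 (volume.restrict T))
    (hf' : MemLp f' 2 (volume.restrict T)) (hg : MemLp g 2 (volume.restrict T)) :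
    l2inner T (f + f') g = l2inner T f g + l2inner T f' g := by
  simp only [l2inner, Pi.add_apply, inner_add_left]
  exact integral_add (integrable_inner hf hg) (integrable_inner hf' hg)

theorem l2inner_add_right {f g g' : Pt n → Form n} (hf : MemLp f 2 (volume.restrict T))
    (hg : MemLp g 2 (volume.restrict T)) (hg' : MemLp g' 2 (volume.restrict T)) :
    l2inner T f (g + g') = l2inner T f g + l2inner T f g' := by
  rw [l2inner_comm, l2inner_add_left hg hg' hf, l2inner_comm g, l2inner_comm g']

theorem l2inner_sub_left {f f' g : Pt n → Form n} (hf : MemLp f 2 (volume.restrict T))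
    (hf' : MemLp f' 2 (volume.restrict T)) (hg : MemLp g 2 (volume.restrict T)) :
    l2inner T (f - f') g = l2inner T f g - l2inner T f' g := by
  simp only [l2inner, Pi.sub_apply, inner_sub_left]
  exact integral_sub (integrable_inner hf hg) (integrable_inner hf' hg)

theorem l2inner_smul_left (s : ℝ) (f g : Pt n → Form n) :
    l2inner T (s • f) g = s * l2inner T f g := by
  simp only [l2inner, Pi.smul_apply, real_inner_smul_left, integral_const_mul]

theorem l2inner_smul_right (s : ℝ) (f g : Pt n → Form n) :
    l2inner T f (s • g) = s * l2inner T f g := by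
  rw [l2inner_comm, l2inner_smul_left, l2inner_comm]

/-- The functional `c ↦ ∫_T ⟪f, Φ c⟫`. -/
def l2functional {f : Pt n → Form n} (hf : MemLp f 2 (volume.restrict T))
    (Φ : Form n →ₗ[ℝ] (Pt n → Form n)) (hΦ : ∀ c, MemLp (Φ c) 2 (volume.restrict T)) :
    Form n →ₗ[ℝ] ℝ where
  toFun c := l2inner T f (Φ c)
  map_add' c d := by rw [map_add, l2inner_add_right hf (hΦ c) (hΦ d)]
  map_smul' s c := by rw [map_smul, l2inner_smul_right, smul_eq_mul, RingHom.id_apply]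

theorem memLp_constL (hb : Bornology.IsBounded T) (v : Form n) :
    MemLp (constL n v) 2 (volume.restrict T) := memLp_of_continuous hb (continuous_constL v)

theorem memLp_linL (hb : Bornology.IsBounded T) (b : Pt n) (L : Fin n → Form n →ₗ[ℝ] Form n)
    (v : Form n) : MemLp (linL b L v) 2 (volume.restrict T) :=
  memLp_of_continuous hb (continuous_linL b L v)

theorem memLp_bubbleL (hb : Bornology.IsBounded T) (v : Form n) :
    MemLp (bubbleL T v) 2 (volume.restrict T) := by
  have h := continuous_enr (T := T) 0 0 0 v
  simp only [enr, map_zero, zero_add] at h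
  exact memLp_of_continuous hb h

theorem integrableOn_of_continuous (hb : Bornology.IsBounded T) {f : Pt n → ℝ}
    (hf : Continuous f) : IntegrableOn f T volume :=
  (hf.continuousOn.integrableOn_compact hb.isCompact_closure).mono_set subset_closure

theorem volume_real_pos (hT : IsOpen T) (hne : T.Nonempty) (hb : Bornology.IsBounded T) :
    0 < volume.real T :=
  ENNReal.toReal_pos (hT.measure_pos volume hne).ne' hb.measure_lt_top.ne

theorem setIntegral_sub_setAverage (hb : Bornology.IsBounded T) (f : Pt n → ℝ) :
    ∫ x in T, (f x - ⨍ y in T, f y) = 0 := by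
  have : IsFiniteMeasure (volume.restrict T) :=
    ⟨by rw [Measure.restrict_apply_univ]; exact hb.measure_lt_top⟩
  exact integral_sub_average _ _

theorem setIntegral_sub_bary (hb : Bornology.IsBounded T) (j : Fin n) :
    ∫ x in T, (x j - bary T j) = 0 :=
  setIntegral_sub_setAverage hb fun x : Pt n => x j

theorem setIntegral_sub_secondMoment (hb : Bornology.IsBounded T) (j : Fin n) :
    ∫ x in T, ((x j - bary T j) ^ 2 - secondMoment T j) = 0 :=
  setIntegral_sub_setAverage hb fun x : Pt n => (x j - bary T j) ^ 2

theorem l2inner_constL_constL (u v : Form n) :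
    l2inner T (constL n u) (constL n v) = volume.real T * inner ℝ u v := by
  simp [l2inner, constL_apply]

theorem l2inner_linL_constL (hb : Bornology.IsBounded T) (L : Fin n → Form n →ₗ[ℝ] Form n)
    (u v : Form n) : l2inner T (linL (bary T) L u) (constL n v) = 0 := by
  simp only [l2inner, linL_apply, constL_apply, sum_inner, real_inner_smul_left]
  rw [integral_finsetSum _ fun j _ => integrableOn_of_continuous hb (by fun_prop)]
  refine Finset.sum_eq_zero fun j _ => ?_
  rw [integral_mul_const, setIntegral_sub_bary hb, zero_mul]

theorem l2inner_constL_linL (hb : Bornology.IsBounded T) (L : Fin n → Form n →ₗ[ℝ] Form n)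
    (u v : Form n) : l2inner T (constL n u) (linL (bary T) L v) = 0 := by
  rw [l2inner_comm, l2inner_linL_constL hb]

theorem l2inner_bubbleL_constL (hb : Bornology.IsBounded T) (u v : Form n) :
    l2inner T (bubbleL T u) (constL n v) = 0 := by
  simp only [l2inner, bubbleL_apply, constL_apply, sum_inner, real_inner_smul_left]
  rw [integral_finsetSum _ fun j _ => integrableOn_of_continuous hb (by fun_prop)]
  refine Finset.sum_eq_zero fun j _ => ?_
  rw [integral_mul_const, setIntegral_sub_secondMoment hb, zero_mul]

/-- The linear parts integrate to zero about the barycentre and the bubbles have mean zero, so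
constants see only `p`. -/
theorem l2inner_enr_constL (hb : Bornology.IsBounded T) (p q r a c : Form n) :
    l2inner T (enr T p q r a) (constL n c) = volume.real T * inner ℝ p c := by
  have h1 := memLp_constL hb p
  have h2 := memLp_linL hb (bary T) contr q
  have h3 := memLp_linL hb (bary T) wedge r
  have h4 := memLp_bubbleL hb a
  have h5 := memLp_constL hb c
  rw [enr, l2inner_add_left ((h1.add h2).add h3) h4 h5, l2inner_add_left (h1.add h2) h3 h5,
    l2inner_add_left h1 h2 h5, l2inner_constL_constL, l2inner_linL_constL hb,
    l2inner_linL_constL hb, l2inner_bubbleL_constL hb]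
  ring

end InnerProduct

/-! ### The interpolation conditions as a triangular system -/

section CellSystem

variable {n m : ℕ} {T : Set (Pt n)}

/-- The equations for the coefficients of the interpolant of an `(m+1)`-form `μ` with exterior
derivative `g` and codifferential `f`. -/
structure CellSystem (m : ℕ) (T : Set (Pt n)) (μ g f : Pt n → Form n) (p q r a : Form n) :
    Prop where
  eq_q : ∀ e ∈ Alt n (m + 2), ((m : ℝ) + 2) * (volume.real T * inner ℝ q e) =
    l2inner T g (constL n e)
  eq_r : ∀ e ∈ Alt n m, codiffSign n (m + 1) * (n - m) * (volume.real T * inner ℝ r e) =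
    l2inner T f (constL n e)
  eq_p : ∀ c ∈ Alt n (m + 1), -(((m : ℝ) + 1) * (volume.real T * inner ℝ p c)) =
    l2inner T f (linL (bary T) contr c) - ((m : ℝ) + 1) * l2inner T μ (constL n c)
  eq_a : ∀ c ∈ Alt n (m + 1),
    2 * l2inner T (linL (bary T) wedge a) (linL (bary T) wedge c) -
      codiffSign n (m + 2) * (n - (m + 1)) * (volume.real T * inner ℝ p c) =
    l2inner T g (linL (bary T) wedge c) -
      codiffSign n (m + 2) * (n - (m + 1)) * l2inner T μ (constL n c)

theorem l2inner_add_constL_linL (hb : Bornology.IsBounded T) {f : Pt n → Form n}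
    (hf : MemLp f 2 (volume.restrict T)) (b : Pt n) (L : Fin n → Form n →ₗ[ℝ] Form n)
    (e c : Form n) : l2inner T f (constL n e + linL b L c) =
      l2inner T f (constL n e) + l2inner T f (linL b L c) :=
  l2inner_add_right hf (memLp_constL hb e) (memLp_linL hb b L c)

/-- With constant and linear test parts separated, all cross terms between constants and forms
linear in x̃ vanish. This decoupling is what makes the system triangular. -/
theorem isCellInterpolant_enr_iff (hT : IsOpen T) (hb : Bornology.IsBounded T)
    {μ : Pt n → Form n} (hμ : Admissible T μ) {p q r a : Form n} (hp : p ∈ Alt n (m + 1))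
    (hq : q ∈ Alt n (m + 2)) (hr : r ∈ Alt n m) (ha : a ∈ Alt n (m + 1)) :
    IsCellInterpolant (m + 1) T μ (enr T p q r a) ↔
      CellSystem m T μ (weakD T μ) (codiff (m + 1) T μ) p q r a := by
  have hmem : enr T p q r a ∈ enriched (m + 1) T :=
    mem_enriched.2 ⟨p, hp, q, hq, r, hr, a, ha, rfl⟩
  have hg := hμ.hasWeakD.memLp
  have hf := hμ.memLp_codiff (m + 1)
  have hw := weakD_enr hT hb (k := m + 1) p r a hq
  have hc := codiff_enr hT hb p hq hr ha
  have key1 : ∀ e ∈ Alt n (m + 2), ∀ c ∈ Alt n (m + 1),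
      ((l2inner T (weakD T (enr T p q r a)) (constL n e + linL (bary T) wedge c) -
        l2inner T (enr T p q r a) (codiff (m + 1 + 1) T (constL n e + linL (bary T) wedge c)) =
      l2inner T (weakD T μ) (constL n e + linL (bary T) wedge c) -
        l2inner T μ (codiff (m + 1 + 1) T (constL n e + linL (bary T) wedge c))) ↔
      ((m : ℝ) + 2) * (volume.real T * inner ℝ q e) +
        (2 * l2inner T (linL (bary T) wedge a) (linL (bary T) wedge c) -
          codiffSign n (m + 2) * (n - (m + 1)) * (volume.real T * inner ℝ p c)) =
      l2inner T (weakD T μ) (constL n e) + (l2inner T (weakD T μ) (linL (bary T) wedge c) -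
        codiffSign n (m + 2) * (n - (m + 1)) * l2inner T μ (constL n c))) := by
    intro e he c hc'
    have ht := codiff_testStar hT hb (bary T) e hc'
    rw [l2inner_congr hw Filter.EventuallyEq.rfl, l2inner_congr Filter.EventuallyEq.rfl ht,
      l2inner_congr (f := μ) Filter.EventuallyEq.rfl ht,
      l2inner_add_left (memLp_constL hb _) ((memLp_linL hb _ _ _).const_smul _)
        ((memLp_constL hb e).add (memLp_linL hb _ _ c)), l2inner_smul_left,
      l2inner_add_constL_linL hb (memLp_constL hb _),
      l2inner_add_constL_linL hb (memLp_linL hb _ _ _), l2inner_add_constL_linL hb hg,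
      l2inner_constL_constL, l2inner_constL_linL hb, l2inner_linL_constL hb, map_smul,
      l2inner_smul_right, l2inner_smul_right, l2inner_enr_constL hb, real_inner_smul_left]
    push_cast
    constructor <;> intro h <;> linear_combination h
  have key2 : ∀ e ∈ Alt n m, ∀ c ∈ Alt n (m + 1),
      ((l2inner T (codiff (m + 1) T (enr T p q r a)) (constL n e + linL (bary T) contr c) -
        l2inner T (enr T p q r a) (weakD T (constL n e + linL (bary T) contr c)) =
      l2inner T (codiff (m + 1) T μ) (constL n e + linL (bary T) contr c) -
        l2inner T μ (weakD T (constL n e + linL (bary T) contr c))) ↔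
      codiffSign n (m + 1) * (n - m) * (volume.real T * inner ℝ r e) +
        -(((m : ℝ) + 1) * (volume.real T * inner ℝ p c)) =
      l2inner T (codiff (m + 1) T μ) (constL n e) +
        (l2inner T (codiff (m + 1) T μ) (linL (bary T) contr c) -
          ((m : ℝ) + 1) * l2inner T μ (constL n c))) := by
    intro e he c hc'
    have ht := weakD_test hT hb (bary T) e hc'
    rw [l2inner_congr hc Filter.EventuallyEq.rfl, l2inner_congr Filter.EventuallyEq.rfl ht,
      l2inner_congr (f := μ) Filter.EventuallyEq.rfl ht,
      l2inner_add_constL_linL hb (memLp_constL hb _), l2inner_add_constL_linL hb hf,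
      l2inner_constL_constL, l2inner_constL_linL hb, map_smul,
      l2inner_smul_right, l2inner_smul_right, l2inner_enr_constL hb, real_inner_smul_left]
    push_cast
    constructor <;> intro h <;> linear_combination h
  have z : ∀ f : Pt n → Form n, l2inner T f 0 = 0 := fun f => by simp [l2inner]
  constructor
  · rintro ⟨-, h1, h2⟩
    have h1' := fun e he c hc => (key1 e he c hc).1 (h1 _ ((mem_trimmedStar (bary T)).2
      ⟨e, he, c, hc, rfl⟩))
    have h2' := fun e he c hc => (key2 e he c hc).1 (h2 _ ((mem_trimmed (bary T)).2
      ⟨e, he, c, hc, rfl⟩))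
    -- Taking the linear or the constant part of the test form to be zero isolates one equation at a
    -- time.
    refine ⟨fun e he => ?_, fun e he => ?_, fun c hc => ?_, fun c hc => ?_⟩
    · simpa [z] using h1' e he 0 (Submodule.zero_mem _)
    · simpa [z] using h2' e he 0 (Submodule.zero_mem _)
    · simpa [z] using h2' 0 (Submodule.zero_mem _) c hc
    · simpa [z] using h1' 0 (Submodule.zero_mem _) c hc
  · intro h
    refine ⟨hmem, fun η hη => ?_, fun τ hτ => ?_⟩
    · obtain ⟨e, he, c, hc, rfl⟩ := (mem_trimmedStar (bary T)).1 hη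
      rw [key1 e he c hc, h.eq_q e he, h.eq_a c hc]
    · obtain ⟨e, he, c, hc, rfl⟩ := (mem_trimmed (bary T)).1 hτ
      rw [key2 e he c hc, h.eq_r e he, h.eq_p c hc]

end CellSystem

/-! ### Geometry of a cell -/

section Geometry

variable {n : ℕ} {T : Set (Pt n)}

theorem linL_translate (b : Pt n) (L : Fin n → Form n →ₗ[ℝ] Form n) (v : Form n) (j : Fin n)
    (t : ℝ) (x : Pt n) :
    linL b L v (x + EuclideanSpace.single j t) = linL b L v x + t • L j v := by
  simp only [linL_apply, PiLp.add_apply, PiLp.single_apply, add_sub_right_comm, add_smul,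
    Finset.sum_add_distrib, ite_smul, zero_smul]
  simp

/-- The form is affine in `x`, so a shift by `r / 2` along the `j`-th axis changes it by `(r / 2) •
L j v`. Half the squared change is at most the sum of the squared norms at the two points; this is
integrated over the ball of radius `r / 2`, which stays inside the larger ball when shifted. -/
theorem volume_ball_mul_norm_sq_le (hb : Bornology.IsBounded T) (b c : Pt n)
    {r : ℝ} (hr : 0 < r) (hball : Metric.ball c r ⊆ T) (L : Fin n → Form n →ₗ[ℝ] Form n)
    (v : Form n) (j : Fin n) :
    r ^ 2 / 8 * volume.real (Metric.ball c (r / 2)) * ‖L j v‖ ^ 2 ≤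
      2 * l2inner T (linL b L v) (linL b L v) := by
  set F : Pt n → Form n := linL b L v with hF
  have hFc : Continuous F := continuous_linL b L v
  have hGc : Continuous (fun x => inner ℝ (F x) (F x)) := hFc.inner hFc
  set h : Pt n := EuclideanSpace.single j (r / 2) with hh
  have hsub : ∀ s ⊆ T, ∫ x in s, inner ℝ (F x) (F x) ≤ l2inner T F F := fun s hs =>
    setIntegral_mono_set (integrableOn_of_continuous hb hGc)
      (Filter.Eventually.of_forall fun x => real_inner_self_nonneg)
      (LE.le.eventuallyLE hs)
  have h1 : ∫ x in Metric.ball c (r / 2), inner ℝ (F x) (F x) ≤ l2inner T F F :=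
    hsub _ ((Metric.ball_subset_ball (by linarith)).trans hball)
  have h2 : ∫ x in Metric.ball c (r / 2), inner ℝ (F (x + h)) (F (x + h)) ≤ l2inner T F F := by
    have e : Metric.ball c (r / 2) = (fun x => x + h) ⁻¹' Metric.ball (c + h) (r / 2) := by
      ext x; simp [Metric.mem_ball]
    rw [e, (measurePreserving_add_right volume h).setIntegral_preimage_emb
      (measurableEmbedding_addRight h) (fun x => inner ℝ (F x) (F x))]
    refine hsub _ ((Metric.ball_subset_ball' ?_).trans hball)
    rw [dist_self_add_left, hh, PiLp.norm_single, Real.norm_of_nonneg (by linarith)]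
    linarith
  have hbb : Bornology.IsBounded (Metric.ball c (r / 2)) := Metric.isBounded_ball
  have i1 := integrableOn_of_continuous hbb hGc
  have i2 : IntegrableOn (fun x => inner ℝ (F (x + h)) (F (x + h))) (Metric.ball c (r / 2)) :=
    integrableOn_of_continuous hbb (hGc.comp (continuous_add_const h))
  have h3 : ∫ x in Metric.ball c (r / 2), r ^ 2 / 8 * ‖L j v‖ ^ 2 ≤
      ∫ x in Metric.ball c (r / 2), (inner ℝ (F x) (F x) + inner ℝ (F (x + h)) (F (x + h))) := by
    refine setIntegral_mono_on (integrableOn_of_continuous hbb continuous_const) (i1.add i2)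
      measurableSet_ball fun x _ => ?_
    have e : F (x + h) = F x + (r / 2) • L j v := linL_translate b L v j _ x
    have p1 : 0 ≤ ‖F x + F (x + h)‖ ^ 2 := sq_nonneg _
    have p2 : ‖F (x + h) - F x‖ ^ 2 = r ^ 2 / 4 * ‖L j v‖ ^ 2 := by
      rw [e, add_sub_cancel_left, norm_smul, Real.norm_of_nonneg (by linarith)]; ring
    rw [norm_add_sq_real] at p1
    rw [norm_sub_sq_real, real_inner_comm] at p2
    rw [real_inner_self_eq_norm_sq, real_inner_self_eq_norm_sq]
    linarith
  rw [integral_add i1 i2, setIntegral_const, smul_eq_mul] at h3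
  linarith

theorem volume_ball_mul_norm_sq_le_wedge (hb : Bornology.IsBounded T) (b c : Pt n)
    {r : ℝ} (hr : 0 < r) (hball : Metric.ball c r ⊆ T) {k : ℕ} (hk : k + 1 ≤ n) {a : Form n}
    (ha : a ∈ Alt n k) :
    r ^ 2 * volume.real (Metric.ball c (r / 2)) * ‖a‖ ^ 2 ≤
      16 * n * l2inner T (linL b wedge a) (linL b wedge a) := by
  -- Summing over all directions recovers the full norm of `a` because its degree is below `n`; on
  -- top-degree forms every `wedge j` would vanish.
  have h1 : ∑ j, ‖wedge j a‖ ^ 2 = ((n : ℝ) - k) * ‖a‖ ^ 2 := by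
    simp only [← real_inner_self_eq_norm_sq, inner_wedge_left]
    rw [← inner_sum, sum_contr_wedge ha, real_inner_smul_right]
  have h2 := Finset.sum_le_sum fun j (_ : j ∈ Finset.univ) =>
    volume_ball_mul_norm_sq_le hb b c hr hball wedge a j
  rw [← Finset.mul_sum, h1, Finset.sum_const, Finset.card_univ, Fintype.card_fin,
    nsmul_eq_mul] at h2
  have h3 : (1 : ℝ) ≤ (n : ℝ) - k := by
    have : ((k + 1 : ℕ) : ℝ) ≤ n := by exact_mod_cast hk
    push_cast at this; linarith
  have h4 : r ^ 2 / 8 * volume.real (Metric.ball c (r / 2)) * (1 * ‖a‖ ^ 2) ≤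
      r ^ 2 / 8 * volume.real (Metric.ball c (r / 2)) * (((n : ℝ) - k) * ‖a‖ ^ 2) := by
    gcongr
  linarith

theorem eq_zero_of_l2inner_linL_wedge (hT : IsOpen T) (hne : T.Nonempty)
    (hb : Bornology.IsBounded T) (b : Pt n) {k : ℕ} (hk : k + 1 ≤ n) {a : Form n}
    (ha : a ∈ Alt n k) (h : l2inner T (linL b wedge a) (linL b wedge a) = 0) : a = 0 := by
  obtain ⟨c, hc⟩ := hne
  obtain ⟨r, hr, hball⟩ := Metric.isOpen_iff.1 hT c hc
  have h1 := volume_ball_mul_norm_sq_le_wedge hb b c hr hball hk ha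
  rw [h, mul_zero] at h1
  have hv : 0 < volume.real (Metric.ball c (r / 2)) :=
    volume_real_pos Metric.isOpen_ball ⟨c, Metric.mem_ball_self (by linarith)⟩
      Metric.isBounded_ball
  by_contra hne
  have : 0 < ‖a‖ := norm_pos_iff.2 hne
  have : 0 < r ^ 2 * volume.real (Metric.ball c (r / 2)) * ‖a‖ ^ 2 := by positivity
  linarith

/-- The constant in the lower bound for the wedge product with the position field. -/
def wedgeConst (n : ℕ) (σ : ℝ) : ℝ := √(16 * n * (|σ| ^ 2 * (2 * |σ|) ^ n))

/-- Shape regularity bounds the diameter by `|σ| * r`, and places `T` in a ball of that radius about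
`c`, so |T| is at most `(2 * |σ|) ^ n` times the volume of the half-radius ball in the previous
bound. -/
theorem diam_mul_norm_le (hb : Bornology.IsBounded T) (b c : Pt n) {σ r : ℝ}
    (hr : 0 < r) (hball : Metric.ball c r ⊆ T) (hσ : Metric.diam T ≤ σ * r) {k : ℕ}
    (hk : k + 1 ≤ n) {a : Form n} (ha : a ∈ Alt n k) :
    Metric.diam T * √(volume.real T) * ‖a‖ ≤
      wedgeConst n σ * (l2norm T (linL b wedge a)).toReal := by
  have hσ' : Metric.diam T ≤ |σ| * r := hσ.trans (by gcongr; exact le_abs_self σ)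
  have hcT : c ∈ T := hball (Metric.mem_ball_self hr)
  have h0 : 0 ≤ Metric.diam T := Metric.diam_nonneg
  have hvol : volume.real T ≤ (2 * |σ|) ^ n * volume.real (Metric.ball c (r / 2)) := by
    have hsub : T ⊆ Metric.closedBall c (|σ| * r) := fun x hx =>
      (Metric.dist_le_diam_of_mem hb hx hcT).trans hσ'
    have h1 : volume.real T ≤ volume.real (Metric.closedBall c (|σ| * r)) :=
      measureReal_mono hsub Metric.isBounded_closedBall.measure_lt_top.ne
    rw [Measure.addHaar_real_closedBall _ _ (by positivity)] at h1
    have h2 : volume.real (Metric.ball c (r / 2)) =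
        (r / 2) ^ Module.finrank ℝ (Pt n) * volume.real (Metric.ball (0 : Pt n) 1) := by
      rw [measureReal_def, Measure.addHaar_ball_of_pos _ _ (by positivity), ENNReal.toReal_mul,
        ENNReal.toReal_ofReal (by positivity), measureReal_def]
    rw [h2]
    refine h1.trans (le_of_eq ?_)
    rw [finrank_euclideanSpace_fin, ← mul_assoc, ← mul_pow]
    ring_nf
  have h1 := volume_ball_mul_norm_sq_le_wedge hb b c hr hball hk ha
  rw [l2inner_self (memLp_linL hb b wedge a)] at h1
  have hV : √(volume.real T) ^ 2 = volume.real T := Real.sq_sqrt measureReal_nonneg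
  have hK : wedgeConst n σ ^ 2 = 16 * n * (|σ| ^ 2 * (2 * |σ|) ^ n) :=
    Real.sq_sqrt (by positivity)
  have hK0 : 0 ≤ wedgeConst n σ := Real.sqrt_nonneg _
  refine le_of_sq_le_sq ?_ (mul_nonneg hK0 ENNReal.toReal_nonneg)
  rw [mul_pow, mul_pow, mul_pow, hV, hK]
  calc Metric.diam T ^ 2 * volume.real T * ‖a‖ ^ 2
      ≤ (|σ| * r) ^ 2 * ((2 * |σ|) ^ n * volume.real (Metric.ball c (r / 2))) * ‖a‖ ^ 2 := by gcongr
    _ = |σ| ^ 2 * (2 * |σ|) ^ n * (r ^ 2 * volume.real (Metric.ball c (r / 2)) * ‖a‖ ^ 2) := by ring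
    _ ≤ |σ| ^ 2 * (2 * |σ|) ^ n * (16 * n * (l2norm T (linL b wedge a)).toReal ^ 2) := by gcongr
    _ = _ := by ring

theorem abs_sub_setAverage_le (hT : IsOpen T) (hb : Bornology.IsBounded T) {f : Pt n → ℝ}
    (hf : Continuous f) {D : ℝ} {x : Pt n} (hx : x ∈ T) (h : ∀ y ∈ T, |f x - f y| ≤ D) :
    |f x - ⨍ y in T, f y| ≤ D := by
  have hV := volume_real_pos hT ⟨x, hx⟩ hb
  have h1 : ‖∫ y in T, (f x - f y)‖ ≤ D * volume.real T :=
    norm_setIntegral_le_of_norm_le_const hb.measure_lt_top h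
  rw [integral_sub (integrableOn_of_continuous hb continuous_const)
    (integrableOn_of_continuous hb hf), setIntegral_const, smul_eq_mul] at h1
  have h2 : volume.real T * f x - ∫ y in T, f y = volume.real T * (f x - ⨍ y in T, f y) := by
    rw [setAverage_eq, smul_eq_mul]; field_simp
  rw [h2, Real.norm_eq_abs, abs_mul, abs_of_pos hV, mul_comm] at h1
  exact le_of_mul_le_mul_right h1 hV

/-- The barycentre is an average of points of `T`, so it suffices to average the coordinate
differences; convexity of `T` plays no role. -/
theorem abs_sub_bary_le (hT : IsOpen T) (hb : Bornology.IsBounded T) {x : Pt n} (hx : x ∈ T)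
    (j : Fin n) : |x j - bary T j| ≤ Metric.diam T := by
  refine abs_sub_setAverage_le hT hb (f := fun y : Pt n => y j) (by fun_prop) hx fun y hy => ?_
  refine le_trans ?_ (Metric.dist_le_diam_of_mem hb hx hy)
  rw [dist_eq_norm]
  exact PiLp.norm_apply_le (x - y) j

theorem abs_sub_secondMoment_le (hT : IsOpen T) (hb : Bornology.IsBounded T) {x : Pt n}
    (hx : x ∈ T) (j : Fin n) :
    |(x j - bary T j) ^ 2 - secondMoment T j| ≤ Metric.diam T ^ 2 := by
  refine abs_sub_setAverage_le hT hb (f := fun y : Pt n => (y j - bary T j) ^ 2) (by fun_prop) hx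
    fun y hy => ?_
  have h : ∀ z ∈ T, (z j - bary T j) ^ 2 ≤ Metric.diam T ^ 2 := fun z hz =>
    sq_le_sq' (abs_le.1 (abs_sub_bary_le hT hb hz j)).1 (abs_le.1 (abs_sub_bary_le hT hb hz j)).2
  rw [abs_le]
  constructor <;> nlinarith [h x hx, h y hy, sq_nonneg (x j - bary T j), sq_nonneg (y j - bary T j)]

theorem l2norm_toReal_le (hT : IsOpen T) (hb : Bornology.IsBounded T) {f : Pt n → Form n}
    (hf : Continuous f) {D : ℝ} (hD : 0 ≤ D) (h : ∀ x ∈ T, ‖f x‖ ≤ D) :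
    (l2norm T f).toReal ≤ √(volume.real T) * D := by
  refine le_of_sq_le_sq ?_ (by positivity)
  rw [← l2inner_self (memLp_of_continuous hb hf), mul_pow, Real.sq_sqrt measureReal_nonneg]
  calc l2inner T f f ≤ ∫ x in T, D ^ 2 := by
        refine setIntegral_mono_on (integrableOn_of_continuous hb (hf.inner hf))
          (integrableOn_of_continuous hb continuous_const) hT.measurableSet fun x hx => ?_
        rw [real_inner_self_eq_norm_sq]
        have := h x hx
        gcongr
    _ = _ := by rw [setIntegral_const, smul_eq_mul]

theorem l2norm_constL_toReal (hb : Bornology.IsBounded T) (v : Form n) :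
    (l2norm T (constL n v)).toReal = √(volume.real T) * ‖v‖ := by
  refine (sq_eq_sq₀ ENNReal.toReal_nonneg (by positivity)).1 ?_
  rw [← l2inner_self (memLp_constL hb v), l2inner_constL_constL, mul_pow,
    Real.sq_sqrt measureReal_nonneg, real_inner_self_eq_norm_sq]

theorem l2norm_linL_toReal_le (hT : IsOpen T) (hb : Bornology.IsBounded T)
    {L : Fin n → Form n →ₗ[ℝ] Form n} (hL : ∀ j v, ‖L j v‖ ≤ ‖v‖) (v : Form n) :
    (l2norm T (linL (bary T) L v)).toReal ≤ √(volume.real T) * (n * (Metric.diam T * ‖v‖)) := by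
  have h0 : 0 ≤ Metric.diam T := Metric.diam_nonneg
  refine l2norm_toReal_le hT hb (continuous_linL _ _ _) (by positivity) fun x hx => ?_
  rw [linL_apply]
  refine (norm_sum_le _ _).trans ((Finset.sum_le_sum fun j _ => ?_).trans_eq
    (by rw [Finset.sum_const, Finset.card_univ, Fintype.card_fin, nsmul_eq_mul]))
  rw [norm_smul, Real.norm_eq_abs]
  gcongr
  · exact abs_sub_bary_le hT hb hx j
  · exact hL j v

theorem l2norm_bubbleL_toReal_le (hT : IsOpen T) (hb : Bornology.IsBounded T) (a : Form n) :
    (l2norm T (bubbleL T a)).toReal ≤ √(volume.real T) * (n * (Metric.diam T ^ 2 * ‖a‖)) := by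
  have hc : Continuous (bubbleL T a) := by
    have h := continuous_enr (T := T) 0 0 0 a
    simpa only [enr, map_zero, zero_add] using h
  refine l2norm_toReal_le hT hb hc (by positivity) fun x hx => ?_
  rw [bubbleL_apply]
  refine (norm_sum_le _ _).trans ((Finset.sum_le_sum fun j _ => ?_).trans_eq
    (by rw [Finset.sum_const, Finset.card_univ, Fintype.card_fin, nsmul_eq_mul]))
  rw [norm_smul, Real.norm_eq_abs]
  gcongr
  · exact abs_sub_secondMoment_le hT hb hx j
  · exact norm_contr_wedge_le j a

theorem l2norm_add_toReal_le {f g : Pt n → Form n} (hf : MemLp f 2 (volume.restrict T))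
    (hg : MemLp g 2 (volume.restrict T)) :
    (l2norm T (f + g)).toReal ≤ (l2norm T f).toReal + (l2norm T g).toReal := by
  unfold l2norm
  rw [← ENNReal.toReal_add hf.eLpNorm_ne_top hg.eLpNorm_ne_top]
  exact ENNReal.toReal_mono (ENNReal.add_ne_top.2 ⟨hf.eLpNorm_ne_top, hg.eLpNorm_ne_top⟩)
    (eLpNorm_add_le hf.aestronglyMeasurable hg.aestronglyMeasurable (by norm_num))

end Geometry

/-! ### Solvability and stability of the cell system -/

section Solvability

variable {n m : ℕ} {T : Set (Pt n)}

/-- Definiteness on `W` makes the map from `W` to its dual injective, hence bijective in finite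
dimension. -/
theorem exists_represents (W : Submodule ℝ (Form n)) (B : Form n →ₗ[ℝ] Form n →ₗ[ℝ] ℝ)
    (hB : ∀ x ∈ W, B x x = 0 → x = 0) (l : Form n →ₗ[ℝ] ℝ) :
    ∃ x ∈ W, ∀ y ∈ W, B x y = l y := by
  let Φ : W →ₗ[ℝ] Module.Dual ℝ W := (LinearMap.lcomp ℝ ℝ W.subtype) ∘ₗ B ∘ₗ W.subtype
  have hΦ : Function.Injective Φ := by
    rw [injective_iff_map_eq_zero]
    intro x hx
    exact Subtype.ext (hB x x.2 (LinearMap.congr_fun hx x))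
  obtain ⟨x, hx⟩ := (LinearMap.injective_iff_surjective_of_finrank_eq_finrank
    Subspace.dual_finrank_eq.symm).1 hΦ (l ∘ₗ W.subtype)
  exact ⟨x, x.2, fun y hy => LinearMap.congr_fun hx ⟨y, hy⟩⟩

/-- The bilinear form `(a, c) ↦ 2 ∫_T ⟪x̃ ∧ a, x̃ ∧ c⟫`. -/
def wedgeForm (hb : Bornology.IsBounded T) : Form n →ₗ[ℝ] Form n →ₗ[ℝ] ℝ :=
  LinearMap.mk₂ ℝ
    (fun a c => 2 * l2inner T (linL (bary T) wedge a) (linL (bary T) wedge c))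
    (fun a a' c => by
      simp only [map_add]
      rw [l2inner_add_left (memLp_linL hb _ _ _) (memLp_linL hb _ _ _) (memLp_linL hb _ _ _)]; ring)
    (fun s a c => by simp only [map_smul, l2inner_smul_left, smul_eq_mul]; ring)
    (fun a c c' => by
      simp only [map_add]
      rw [l2inner_add_right (memLp_linL hb _ _ _) (memLp_linL hb _ _ _) (memLp_linL hb _ _ _)]
      ring)
    (fun s a c => by simp only [map_smul, l2inner_smul_right, smul_eq_mul]; ring)

theorem exists_represents_inner (W : Submodule ℝ (Form n)) {s : ℝ} (hs : s ≠ 0)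
    (l : Form n →ₗ[ℝ] ℝ) : ∃ x ∈ W, ∀ y ∈ W, s * inner ℝ x y = l y := by
  obtain ⟨x, hx, h⟩ := exists_represents W (s • innerₗ (Form n)) (fun x _ hx => by
    have h : s * inner ℝ x x = 0 := hx
    exact inner_self_eq_zero.1 ((mul_eq_zero.1 h).resolve_left hs)) l
  exact ⟨x, hx, fun y hy => h y hy⟩

theorem codiffSign_ne_zero (n k : ℕ) : codiffSign n k ≠ 0 := by
  intro h
  have := codiffSign_mul_self n k
  rw [h] at this
  norm_num at this

/-- Solved in triangular order: `q`, `r` and `p` from nonzero multiples of the inner product, then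
`a` from `wedgeForm`, with the known `p` moved to the right-hand side. -/
theorem exists_cellSystem (hT : IsOpen T) (hne : T.Nonempty) (hb : Bornology.IsBounded T)
    (hm : m + 2 ≤ n) {μ g f : Pt n → Form n} (hμ : MemLp μ 2 (volume.restrict T))
    (hg : MemLp g 2 (volume.restrict T)) (hf : MemLp f 2 (volume.restrict T)) :
    ∃ p ∈ Alt n (m + 1), ∃ q ∈ Alt n (m + 2), ∃ r ∈ Alt n m, ∃ a ∈ Alt n (m + 1),
      CellSystem m T μ g f p q r a := by
  have hV := volume_real_pos hT hne hb
  have hnm : ((m : ℝ) + 2) ≤ n := by exact_mod_cast hm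
  have hnm' : (n : ℝ) - m ≠ 0 := by linarith
  obtain ⟨q, hq, h1⟩ := exists_represents_inner (Alt n (m + 2))
    (s := ((m : ℝ) + 2) * volume.real T) (by positivity)
    (l2functional hg (constL n) (memLp_constL hb))
  obtain ⟨r, hr, h2⟩ := exists_represents_inner (Alt n m)
    (s := codiffSign n (m + 1) * (n - m) * volume.real T)
    (mul_ne_zero (mul_ne_zero (codiffSign_ne_zero _ _) hnm') hV.ne')
    (l2functional hf (constL n) (memLp_constL hb))
  obtain ⟨p, hp, h3⟩ := exists_represents_inner (Alt n (m + 1))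
    (s := -(((m : ℝ) + 1) * volume.real T)) (neg_ne_zero.2 (by positivity))
    (l2functional hf (linL (bary T) contr) (memLp_linL hb _ _) -
      ((m : ℝ) + 1) • l2functional hμ (constL n) (memLp_constL hb))
  obtain ⟨a, ha, h4⟩ := exists_represents (Alt n (m + 1)) (wedgeForm hb) (fun x hx h => by
      have h' : 2 * l2inner T (linL (bary T) wedge x) (linL (bary T) wedge x) = 0 := h
      exact eq_zero_of_l2inner_linL_wedge hT hne hb (bary T) (by omega) hx (by linarith))
    (l2functional hg (linL (bary T) wedge) (memLp_linL hb _ _) -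
      (codiffSign n (m + 2) * (n - (m + 1))) • l2functional hμ (constL n) (memLp_constL hb) +
      (codiffSign n (m + 2) * (n - (m + 1)) * volume.real T) • innerₗ (Form n) p)
  refine ⟨p, hp, q, hq, r, hr, a, ha, ⟨fun e he => ?_, fun e he => ?_, fun c hc => ?_,
    fun c hc => ?_⟩⟩
  · exact (by ring : _ = _).trans (h1 e he)
  · exact (by ring : _ = _).trans (h2 e he)
  · exact (by ring : _ = _).trans (h3 c hc)
  · have h : 2 * l2inner T (linL (bary T) wedge a) (linL (bary T) wedge c) =
      l2inner T g (linL (bary T) wedge c) -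
        (codiffSign n (m + 2) * (n - (m + 1))) * l2inner T μ (constL n c) +
        (codiffSign n (m + 2) * (n - (m + 1)) * volume.real T) * inner ℝ p c := h4 c hc
    rw [h]; ring

theorem CellSystem.sub (hb : Bornology.IsBounded T) {μ g f μ' g' f' : Pt n → Form n}
    (hμ : MemLp μ 2 (volume.restrict T)) (hg : MemLp g 2 (volume.restrict T))
    (hf : MemLp f 2 (volume.restrict T)) (hμ' : MemLp μ' 2 (volume.restrict T))
    (hg' : MemLp g' 2 (volume.restrict T)) (hf' : MemLp f' 2 (volume.restrict T))
    {p q r a p' q' r' a' : Form n} (h : CellSystem m T μ g f p q r a)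
    (h' : CellSystem m T μ' g' f' p' q' r' a') :
    CellSystem m T (μ - μ') (g - g') (f - f') (p - p') (q - q') (r - r') (a - a') := by
  refine ⟨fun e he => ?_, fun e he => ?_, fun c hc => ?_, fun c hc => ?_⟩
  · rw [l2inner_sub_left hg hg' (memLp_constL hb e), inner_sub_left]
    linear_combination h.eq_q e he - h'.eq_q e he
  · rw [l2inner_sub_left hf hf' (memLp_constL hb e), inner_sub_left]
    linear_combination h.eq_r e he - h'.eq_r e he
  · rw [l2inner_sub_left hf hf' (memLp_linL hb _ _ c), l2inner_sub_left hμ hμ' (memLp_constL hb c),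
      inner_sub_left]
    linear_combination h.eq_p c hc - h'.eq_p c hc
  · rw [l2inner_sub_left hg hg' (memLp_linL hb _ _ c), l2inner_sub_left hμ hμ' (memLp_constL hb c),
      inner_sub_left, map_sub, l2inner_sub_left (memLp_linL hb _ _ a) (memLp_linL hb _ _ a')
        (memLp_linL hb _ _ c)]
    linear_combination h.eq_a c hc - h'.eq_a c hc

theorem CellSystem.eq_zero (hT : IsOpen T) (hne : T.Nonempty) (hb : Bornology.IsBounded T)
    (hm : m + 2 ≤ n) {p q r a : Form n} (hp : p ∈ Alt n (m + 1)) (hq : q ∈ Alt n (m + 2))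
    (hr : r ∈ Alt n m) (ha : a ∈ Alt n (m + 1)) (h : CellSystem m T 0 0 0 p q r a) :
    p = 0 ∧ q = 0 ∧ r = 0 ∧ a = 0 := by
  have hV := (volume_real_pos hT hne hb).ne'
  have hnm : ((m : ℝ) + 2) ≤ n := by exact_mod_cast hm
  have hnm' : (n : ℝ) - m ≠ 0 := by linarith
  have z : ∀ f : Pt n → Form n, l2inner T 0 f = 0 := fun f => by simp [l2inner]
  have hq' := h.eq_q q hq
  have hr' := h.eq_r r hr
  have hp' := h.eq_p p hp
  have ha' := h.eq_a a ha
  have e2 : (m : ℝ) + 2 ≠ 0 := by positivity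
  have e1 : (m : ℝ) + 1 ≠ 0 := by positivity
  simp only [z, mul_zero, sub_zero, neg_eq_zero, mul_eq_zero, hV, e1, e2, hnm',
    codiffSign_ne_zero, inner_self_eq_zero, false_or] at hq' hr' hp' ha'
  -- Once `p` vanishes the coupling term disappears, and the last equation tested with `a` says that
  -- x̃ ∧ a has norm zero.
  subst hp'
  refine ⟨rfl, hq', hr', eq_zero_of_l2inner_linL_wedge hT hne hb (bary T) (by omega) ha ?_⟩
  simpa using ha'

end Solvability

/-! ### Stability estimates for the coefficients of the cell system -/

section Stability

variable {n m : ℕ} {T : Set (Pt n)}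

/-- Each equation is tested with its own solution; this cancels one power of the norm, including
when that norm is zero. -/
theorem mul_le_of_mul_mul_self_le {c x G : ℝ} (hx : 0 ≤ x) (hG : 0 ≤ G) (h : c * x * x ≤ G * x) :
    c * x ≤ G := by
  rcases hx.eq_or_lt with rfl | hx
  · simpa using hG
  · exact le_of_mul_le_mul_right h hx

theorem abs_codiffSign (n k : ℕ) : |codiffSign n k| = 1 := by
  rcases mul_self_eq_one_iff.1 (codiffSign_mul_self n k) with h | h <;> simp [h]

/-- The constant in the stability estimate on a cell. -/
def stabConst (n : ℕ) (K : ℝ) : ℝ := 3 + 2 * n + n * K * (1 + n ^ 2 * K) + n ^ 2 * K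

theorem CellSystem.norm_q_le (hb : Bornology.IsBounded T) {μ g f : Pt n → Form n}
    (hg : MemLp g 2 (volume.restrict T)) {p q r a : Form n} (hq : q ∈ Alt n (m + 2))
    (h : CellSystem m T μ g f p q r a) :
    ((m : ℝ) + 2) * (√(volume.real T) * ‖q‖) ≤ (l2norm T g).toReal := by
  refine mul_le_of_mul_mul_self_le (by positivity) ENNReal.toReal_nonneg ?_
  have h1 := h.eq_q q hq
  have h2 := (le_abs_self _).trans (abs_l2inner_le hg (memLp_constL hb q))
  rw [l2norm_constL_toReal hb] at h2
  rw [real_inner_self_eq_norm_sq] at h1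
  have hV : √(volume.real T) ^ 2 = volume.real T := Real.sq_sqrt measureReal_nonneg
  calc _ = ((m : ℝ) + 2) * (volume.real T * ‖q‖ ^ 2) := by
            linear_combination (((m : ℝ) + 2) * ‖q‖ ^ 2) * hV
    _ ≤ _ := by rw [h1]; exact h2

theorem CellSystem.norm_r_le (hb : Bornology.IsBounded T) {μ g f : Pt n → Form n}
    (hf : MemLp f 2 (volume.restrict T)) {p q r a : Form n} (hr : r ∈ Alt n m)
    (h : CellSystem m T μ g f p q r a) :
    ((n : ℝ) - m) * (√(volume.real T) * ‖r‖) ≤ (l2norm T f).toReal := by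
  refine mul_le_of_mul_mul_self_le (by positivity) ENNReal.toReal_nonneg ?_
  have h1 := h.eq_r r hr
  have h2 := abs_l2inner_le hf (memLp_constL hb r)
  rw [l2norm_constL_toReal hb, ← h1, real_inner_self_eq_norm_sq, abs_mul, abs_mul, abs_codiffSign,
    one_mul, ← abs_mul] at h2
  have hV : √(volume.real T) ^ 2 = volume.real T := Real.sq_sqrt measureReal_nonneg
  calc _ = ((n : ℝ) - m) * (volume.real T * ‖r‖ ^ 2) := by
            linear_combination (((n : ℝ) - m) * ‖r‖ ^ 2) * hV
    _ ≤ _ := (le_abs_self _).trans h2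

theorem CellSystem.norm_p_le (hT : IsOpen T) (hb : Bornology.IsBounded T) {μ g f : Pt n → Form n}
    (hμ : MemLp μ 2 (volume.restrict T)) (hf : MemLp f 2 (volume.restrict T)) {p q r a : Form n}
    (hp : p ∈ Alt n (m + 1)) (h : CellSystem m T μ g f p q r a) :
    √(volume.real T) * ‖p‖ ≤
      (l2norm T μ).toReal + n * (Metric.diam T * (l2norm T f).toReal) := by
  have hd : 0 ≤ Metric.diam T := Metric.diam_nonneg
  have hF : 0 ≤ (l2norm T f).toReal := ENNReal.toReal_nonneg
  have hM : 0 ≤ (l2norm T μ).toReal := ENNReal.toReal_nonneg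
  have h1 := h.eq_p p hp
  have h2 := (neg_abs_le _).trans' (neg_le_neg (abs_l2inner_le hf (memLp_linL hb (bary T) contr p)))
  have h3 := (le_abs_self _).trans (abs_l2inner_le hμ (memLp_constL hb p))
  have h4 := mul_le_mul_of_nonneg_left (l2norm_linL_toReal_le hT hb norm_contr_le p) hF
  rw [l2norm_constL_toReal hb] at h3
  rw [real_inner_self_eq_norm_sq] at h1
  have hV : √(volume.real T) ^ 2 = volume.real T := Real.sq_sqrt measureReal_nonneg
  have h5 : ((m : ℝ) + 1) * (√(volume.real T) * ‖p‖) ≤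
      ((m : ℝ) + 1) * (l2norm T μ).toReal + n * (Metric.diam T * (l2norm T f).toReal) := by
    refine mul_le_of_mul_mul_self_le (by positivity) (by positivity) ?_
    have h6 := mul_le_mul_of_nonneg_left h3 (by positivity : (0 : ℝ) ≤ (m : ℝ) + 1)
    calc _ = ((m : ℝ) + 1) * (volume.real T * ‖p‖ ^ 2) := by
            linear_combination (((m : ℝ) + 1) * ‖p‖ ^ 2) * hV
      _ ≤ _ := by linarith
  -- The factor `m + 1` multiplies only the μ term on the right, so the other term is enlarged by it
  -- before dividing.
  have hm : (1 : ℝ) ≤ (m : ℝ) + 1 := by linarith [(Nat.cast_nonneg m : (0 : ℝ) ≤ m)]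
  have h7 : (n : ℝ) * (Metric.diam T * (l2norm T f).toReal) ≤
      ((m : ℝ) + 1) * (n * (Metric.diam T * (l2norm T f).toReal)) :=
    le_mul_of_one_le_left (by positivity) hm
  exact le_of_mul_le_mul_left (by linarith) (by linarith : (0 : ℝ) < (m : ℝ) + 1)

/-- The bound is free of μ. Estimating `p` and μ separately would leave a multiple of |T|^{1/2} ‖a‖,
controlled by ‖x̃ ∧ a‖ only at the cost of 1/diam(T). Their difference, however, is a pairing with
x̃ ⌟ a, which supplies the missing power of the diameter. -/
theorem CellSystem.norm_a_le (hT : IsOpen T) (hb : Bornology.IsBounded T) (hm : m + 2 ≤ n)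
    {μ g f : Pt n → Form n} (hg : MemLp g 2 (volume.restrict T))
    (hf : MemLp f 2 (volume.restrict T)) {p q r a : Form n} (ha : a ∈ Alt n (m + 1)) {K : ℝ}
    (hK : Metric.diam T * √(volume.real T) * ‖a‖ ≤
      K * (l2norm T (linL (bary T) wedge a)).toReal) (hK0 : 0 ≤ K)
    (h : CellSystem m T μ g f p q r a) :
    2 * (l2norm T (linL (bary T) wedge a)).toReal ≤
      (l2norm T g).toReal + n ^ 2 * K * (l2norm T f).toReal := by
  set L := (l2norm T (linL (bary T) wedge a)).toReal with hL
  have hL0 : 0 ≤ L := ENNReal.toReal_nonneg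
  have hF : 0 ≤ (l2norm T f).toReal := ENNReal.toReal_nonneg
  have hG : 0 ≤ (l2norm T g).toReal := ENNReal.toReal_nonneg
  refine mul_le_of_mul_mul_self_le hL0 (by positivity) ?_
  have h1 := h.eq_a a ha
  rw [l2inner_self (memLp_linL hb _ _ a), ← hL] at h1
  have h2 := (le_abs_self _).trans (abs_l2inner_le hg (memLp_linL hb (bary T) wedge a))
  -- `w` is the combination of `p` and μ that enters `eq_a`; testing `eq_p` with `a` rewrites it
  -- through the codifferential alone.
  set w := volume.real T * inner ℝ p a - l2inner T μ (constL n a) with hw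
  have h3 : ((m : ℝ) + 1) * w = - l2inner T f (linL (bary T) contr a) := by
    linear_combination -(h.eq_p a ha)
  have h4 : |w| ≤ (l2norm T f).toReal * (n * (K * L)) := by
    have hm1 : (1 : ℝ) ≤ (m : ℝ) + 1 := by linarith [(Nat.cast_nonneg m : (0 : ℝ) ≤ m)]
    calc |w| ≤ ((m : ℝ) + 1) * |w| := le_mul_of_one_le_left (abs_nonneg _) hm1
      _ = |l2inner T f (linL (bary T) contr a)| := by
        rw [← abs_of_pos (by linarith : (0 : ℝ) < (m : ℝ) + 1), ← abs_mul, h3, abs_neg]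
      _ ≤ (l2norm T f).toReal * (l2norm T (linL (bary T) contr a)).toReal :=
        abs_l2inner_le hf (memLp_linL hb _ _ a)
      _ ≤ (l2norm T f).toReal * (√(volume.real T) * (n * (Metric.diam T * ‖a‖))) := by
        gcongr; exact l2norm_linL_toReal_le hT hb norm_contr_le a
      _ = (l2norm T f).toReal * (n * (Metric.diam T * √(volume.real T) * ‖a‖)) := by ring
      _ ≤ _ := by gcongr
  have hnm : ((m : ℝ) + 2) ≤ n := by exact_mod_cast hm
  have h5 : codiffSign n (m + 2) * (n - (m + 1)) * w ≤ n * ((l2norm T f).toReal * (n * (K * L))) := by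
    refine (le_abs_self _).trans ?_
    rw [abs_mul, abs_mul, abs_codiffSign, one_mul, abs_of_nonneg (by linarith)]
    gcongr
    linarith [(Nat.cast_nonneg m : (0 : ℝ) ≤ m)]
  calc 2 * L * L = codiffSign n (m + 2) * (n - (m + 1)) * w +
        l2inner T g (linL (bary T) wedge a) := by rw [hw]; linear_combination h1
    _ ≤ n * ((l2norm T f).toReal * (n * (K * L))) + (l2norm T g).toReal * L := add_le_add h5 h2
    _ = _ := by ring

theorem CellSystem.stability (hT : IsOpen T) (hb : Bornology.IsBounded T)
    (hm : m + 2 ≤ n) {μ g f : Pt n → Form n} (hμ : MemLp μ 2 (volume.restrict T))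
    (hg : MemLp g 2 (volume.restrict T)) (hf : MemLp f 2 (volume.restrict T)) {p q r a : Form n}
    (hp : p ∈ Alt n (m + 1)) (hq : q ∈ Alt n (m + 2)) (hr : r ∈ Alt n m)
    (ha : a ∈ Alt n (m + 1)) {K : ℝ}
    (hK : Metric.diam T * √(volume.real T) * ‖a‖ ≤
      K * (l2norm T (linL (bary T) wedge a)).toReal) (hK0 : 0 ≤ K)
    (h : CellSystem m T μ g f p q r a) :
    let B := stabConst n K * max 1 (Metric.diam T) *
      ((l2norm T μ).toReal + (l2norm T g).toReal + (l2norm T f).toReal)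
    (l2norm T (enr T p q r a)).toReal ≤ B ∧
    (l2norm T (weakD T (enr T p q r a))).toReal ≤ B ∧
    (l2norm T (codiff (m + 1) T (enr T p q r a))).toReal ≤ B := by
  have h1 := h.norm_q_le hb hg hq
  have h2 := h.norm_r_le hb hf hr
  have h3 := h.norm_p_le hT hb hμ hf hp
  have h4 := h.norm_a_le hT hb hm hg hf ha hK hK0
  have hnm : ((m : ℝ) + 2) ≤ n := by exact_mod_cast hm
  have hm0 : (0 : ℝ) ≤ m := Nat.cast_nonneg m
  have hF : 0 ≤ (l2norm T f).toReal := ENNReal.toReal_nonneg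
  have hG : 0 ≤ (l2norm T g).toReal := ENNReal.toReal_nonneg
  have hM : 0 ≤ (l2norm T μ).toReal := ENNReal.toReal_nonneg
  have hL0 : 0 ≤ (l2norm T (linL (bary T) wedge a)).toReal := ENNReal.toReal_nonneg
  have hd : 0 ≤ Metric.diam T := Metric.diam_nonneg
  have hwd : (l2norm T (weakD T (enr T p q r a))).toReal ≤
      ((m : ℝ) + 2) * (√(volume.real T) * ‖q‖) +
        2 * (l2norm T (linL (bary T) wedge a)).toReal := by
    have e : l2norm T (weakD T (enr T p q r a)) = _ :=
      eLpNorm_congr_ae (weakD_enr hT hb (k := m + 1) p r a hq)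
    rw [e]
    refine (l2norm_add_toReal_le (memLp_constL hb _)
      ((memLp_linL hb _ _ _).const_smul _)).trans (le_of_eq ?_)
    congr 1
    · rw [l2norm_constL_toReal hb, norm_smul, Real.norm_of_nonneg (by positivity)]
      push_cast; ring
    · rw [← map_smul, l2norm, map_smul, eLpNorm_const_smul, ENNReal.toReal_mul, l2norm]
      simp
  have hcd : (l2norm T (codiff (m + 1) T (enr T p q r a))).toReal =
      ((n : ℝ) - m) * (√(volume.real T) * ‖r‖) := by
    have e : l2norm T (codiff (m + 1) T (enr T p q r a)) = _ :=
      eLpNorm_congr_ae (codiff_enr hT hb p hq hr ha)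
    rw [e]
    change (l2norm T _).toReal = _
    rw [l2norm_constL_toReal hb, norm_smul, norm_mul, Real.norm_eq_abs, abs_codiffSign, one_mul,
      Real.norm_of_nonneg (by linarith)]
    ring
  have hen : (l2norm T (enr T p q r a)).toReal ≤ √(volume.real T) * ‖p‖ +
      √(volume.real T) * (n * (Metric.diam T * ‖q‖)) +
      √(volume.real T) * (n * (Metric.diam T * ‖r‖)) +
      √(volume.real T) * (n * (Metric.diam T ^ 2 * ‖a‖)) := by
    have i1 := memLp_constL hb p
    have i2 := memLp_linL hb (bary T) contr q
    have i3 := memLp_linL hb (bary T) wedge r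
    refine (l2norm_add_toReal_le ((i1.add i2).add i3) (memLp_bubbleL hb a)).trans
      (add_le_add ?_ (l2norm_bubbleL_toReal_le hT hb a))
    refine (l2norm_add_toReal_le (i1.add i2) i3).trans
      (add_le_add ?_ (l2norm_linL_toReal_le hT hb norm_wedge_le r))
    refine (l2norm_add_toReal_le i1 i2).trans
      (add_le_add (l2norm_constL_toReal hb p).le (l2norm_linL_toReal_le hT hb norm_contr_le q))
  -- All analytic input is now in the hypotheses; what remains is real arithmetic in the norms.
  generalize (l2norm T (enr T p q r a)).toReal = N0 at *
  generalize (l2norm T (weakD T (enr T p q r a))).toReal = N1 at *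
  generalize (l2norm T (codiff (m + 1) T (enr T p q r a))).toReal = N2 at *
  generalize (l2norm T (linL (bary T) wedge a)).toReal = L at *
  generalize (l2norm T μ).toReal = M at *
  generalize (l2norm T g).toReal = G at *
  generalize (l2norm T f).toReal = F at *
  have hS0 : 0 ≤ √(volume.real T) := Real.sqrt_nonneg _
  generalize √(volume.real T) = S at *
  generalize hH : Metric.diam T = H at *
  intro B
  have hX1 : 1 ≤ max 1 H := le_max_left _ _
  have hXH : H ≤ max 1 H := le_max_right _ _
  have hBdef : B = stabConst n K * max 1 H * (M + G + F) := rfl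
  clear_value B
  subst hBdef
  set X := max 1 H
  set W := M + G + F with hW
  have hs0 : 0 ≤ W := by positivity
  have hXs : W ≤ X * W := le_mul_of_one_le_left hs0 hX1
  have hXs0 : 0 ≤ X * W := hs0.trans hXs
  have hn0 : (0 : ℝ) ≤ n := Nat.cast_nonneg n
  have hc1 : 0 ≤ (n : ℝ) * K * (1 + n ^ 2 * K) := by positivity
  have hc2 : 0 ≤ (n : ℝ) ^ 2 * K := by positivity
  -- The three quantities need the constants `1 + 2 * n + n * K * (1 + n ^ 2 * K)`, `2 + n ^ 2 * K`
  -- and `1`; `stabConst` is the sum of the first two and dominates each.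
  have hle : ∀ c : ℝ, c ≤ stabConst n K → c * (X * W) ≤ stabConst n K * X * W := fun c hc => by
    rw [mul_assoc]; gcongr
  have hnKF : (n : ℝ) ^ 2 * K * F ≤ n ^ 2 * K * W := by
    gcongr; linarith
  refine ⟨?_, ?_, ?_⟩
  · have hq0 : 0 ≤ S * ‖q‖ := by positivity
    have hr0 : 0 ≤ S * ‖r‖ := by positivity
    have hq1 : S * ‖q‖ ≤ G := by nlinarith
    have hr1 : S * ‖r‖ ≤ F := by nlinarith
    have hL : L ≤ (1 + n ^ 2 * K) * W := by linarith
    refine le_trans ?_ (hle (1 + 2 * n + n * K * (1 + n ^ 2 * K)) (by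
      unfold stabConst; linarith))
    have t2 : H * F + H * (S * ‖q‖) + H * (S * ‖r‖) ≤ H * (F + G + F) := by
      calc _ = H * (F + S * ‖q‖ + S * ‖r‖) := by ring
        _ ≤ _ := by gcongr
    have t3 : H * (F + G + F) ≤ X * (2 * W) := by gcongr; linarith
    have t4 : S * (n * (H ^ 2 * ‖a‖)) ≤ n * K * (1 + n ^ 2 * K) * (X * W) := by
      calc S * (n * (H ^ 2 * ‖a‖)) = n * (H * (H * S * ‖a‖)) := by ring
        -- Of the two powers of the diameter in the bubble, one is absorbed by the lower bound for
        -- x̃ ∧ a and the other goes into `max 1 H`.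
        _ ≤ n * (X * (K * ((1 + n ^ 2 * K) * W))) :=
          mul_le_mul_of_nonneg_left (mul_le_mul hXH (hK.trans (by gcongr)) (by positivity)
            (by positivity)) hn0
        _ = _ := by ring
    have t5 : (n : ℝ) * (H * F + H * (S * ‖q‖) + H * (S * ‖r‖)) ≤ n * (X * (2 * W)) := by
      gcongr; exact t2.trans t3
    have hMX : M ≤ X * W := by linarith
    linarith
  · refine le_trans ?_ (hle (2 + n ^ 2 * K) (by unfold stabConst; linarith))
    have : (n : ℝ) ^ 2 * K * W ≤ n ^ 2 * K * (X * W) := by gcongr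
    linarith
  · refine le_trans ?_ (hle 1 (by unfold stabConst; linarith))
    linarith

end Stability

/-! ### The interpolant on a cell -/

section CellInterpolant

variable {n m : ℕ} {T : Set (Pt n)}

theorem exists_isCellInterpolant (hT : IsOpen T) (hne : T.Nonempty) (hb : Bornology.IsBounded T)
    (hm : m + 2 ≤ n) {μ : Pt n → Form n} (hμ : Admissible T μ) :
    ∃ ν, IsCellInterpolant (m + 1) T μ ν := by
  obtain ⟨p, hp, q, hq, r, hr, a, ha, h⟩ := exists_cellSystem hT hne hb hm hμ.memLp
    hμ.hasWeakD.memLp (hμ.memLp_codiff (m + 1))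
  exact ⟨_, (isCellInterpolant_enr_iff hT hb hμ hp hq hr ha).2 h⟩

theorem existsUnique_isCellInterpolant (hT : IsOpen T) (hne : T.Nonempty)
    (hb : Bornology.IsBounded T) (hm : m + 2 ≤ n) {μ : Pt n → Form n} (hμ : Admissible T μ) :
    ∃! ν, IsCellInterpolant (m + 1) T μ ν := by
  obtain ⟨ν, hν⟩ := exists_isCellInterpolant hT hne hb hm hμ
  refine ⟨ν, hν, fun ν' hν' => ?_⟩
  obtain ⟨p, hp, q, hq, r, hr, a, ha, rfl⟩ := mem_enriched.1 hν.1
  obtain ⟨p', hp', q', hq', r', hr', a', ha', rfl⟩ := mem_enriched.1 hν'.1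
  have h := (isCellInterpolant_enr_iff hT hb hμ hp hq hr ha).1 hν
  have h' := (isCellInterpolant_enr_iff hT hb hμ hp' hq' hr' ha').1 hν'
  have hg := hμ.hasWeakD.memLp
  have hf := hμ.memLp_codiff (m + 1)
  have hs := h'.sub hb hμ.memLp hg hf hμ.memLp hg hf h
  rw [sub_self, sub_self, sub_self] at hs
  obtain ⟨e1, e2, e3, e4⟩ := hs.eq_zero hT hne hb hm (Submodule.sub_mem _ hp' hp)
    (Submodule.sub_mem _ hq' hq) (Submodule.sub_mem _ hr' hr) (Submodule.sub_mem _ ha' ha)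
  rw [sub_eq_zero.1 e1, sub_eq_zero.1 e2, sub_eq_zero.1 e3, sub_eq_zero.1 e4]

theorem isCellInterpolant_cellInterp (hT : IsOpen T) (hne : T.Nonempty)
    (hb : Bornology.IsBounded T) (hm : m + 2 ≤ n) {μ : Pt n → Form n} (hμ : Admissible T μ) :
    IsCellInterpolant (m + 1) T μ (cellInterp (m + 1) T μ) := by
  have h := exists_isCellInterpolant hT hne hb hm hμ
  rw [cellInterp, dif_pos h]
  exact h.choose_spec

theorem l2norm_sub_le {u v e w : Pt n → Form n} (hu : MemLp e 2 (volume.restrict T))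
    (hw : MemLp w 2 (volume.restrict T)) (h : u - v =ᵐ[volume.restrict T] e - w) :
    l2norm T (u - v) ≤ l2norm T e + l2norm T w := by
  rw [l2norm, eLpNorm_congr_ae h]
  exact eLpNorm_sub_le hu.aestronglyMeasurable hw.aestronglyMeasurable (by norm_num)

/-- The constant of the quasi-optimality estimate on a cell. -/
def cellConst (n : ℕ) (σ : ℝ) : ℝ := 1 + stabConst n (wedgeConst n σ)

theorem stabConst_nonneg {K : ℝ} (hK : 0 ≤ K) : 0 ≤ stabConst n K := by
  unfold stabConst
  positivity

theorem one_le_cellConst (n : ℕ) (σ : ℝ) : 1 ≤ cellConst n σ := by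
  have h : 0 ≤ wedgeConst n σ := Real.sqrt_nonneg _
  have := stabConst_nonneg (n := n) h
  unfold cellConst
  linarith

/-- The coefficients of ν - π solve the cell system with the data of ω - π, so stability bounds ν -
π by the error ω - π; the triangle inequality does the rest. -/
theorem IsCellInterpolant.quasi_optimal (hT : IsOpen T) (hb : Bornology.IsBounded T)
    (hm : m + 2 ≤ n) {σ r : ℝ} {c : Pt n} (hr : 0 < r) (hball : Metric.ball c r ⊆ T)
    (hσ : Metric.diam T ≤ σ * r) {ω ν π : Pt n → Form n} (hω : Admissible T ω)
    (hν : IsCellInterpolant (m + 1) T ω ν) (hπ : π ∈ enriched (m + 1) T) :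
    let B := ENNReal.ofReal (cellConst n σ) * max 1 (Metric.ediam T) *
      (l2norm T (ω - π) + l2norm T (weakD T (ω - π)) + l2norm T (codiff (m + 1) T (ω - π)))
    l2norm T (ω - ν) ≤ B ∧ l2norm T (weakD T ω - weakD T ν) ≤ B ∧
      l2norm T (codiff (m + 1) T ω - codiff (m + 1) T ν) ≤ B := by
  obtain ⟨p, hp, q, hq, r, hr', a, ha, rfl⟩ := mem_enriched.1 hν.1
  obtain ⟨p', hp', q', hq', r', hr'', a', ha', rfl⟩ := mem_enriched.1 hπ
  have hAπ : Admissible T (enr T p' q' r' a') := admissible_enr hb p' q' r' a'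
  have hAν : Admissible T (enr T p q r a) := admissible_enr hb p q r a
  have h := (isCellInterpolant_enr_iff hT hb hω hp hq hr' ha).1 hν
  -- The interpolator reproduces the enriched space: π satisfies its own interpolation conditions
  -- trivially.
  have h' := (isCellInterpolant_enr_iff hT hb hAπ hp' hq' hr'' ha').1
    ⟨hπ, fun _ _ => rfl, fun _ _ => rfl⟩
  have hs := h.sub hb hω.memLp hω.hasWeakD.memLp (hω.memLp_codiff _) hAπ.memLp
    hAπ.hasWeakD.memLp (hAπ.memLp_codiff _) h'
  have hA : Admissible T (ω - enr T p' q' r' a') := hω.sub hAπ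
  have hAd := hω.weakD_sub hT hAπ
  have hAc := hω.codiff_sub hT (m + 1) hAπ
  have hK0 : 0 ≤ wedgeConst n σ := Real.sqrt_nonneg _
  have ha'' : a - a' ∈ Alt n (m + 1) := Submodule.sub_mem _ ha ha'
  obtain ⟨b0, b1, b2⟩ := hs.stability hT hb hm hA.memLp
    (hω.hasWeakD.memLp.sub hAπ.hasWeakD.memLp)
    ((hω.memLp_codiff (m + 1)).sub (hAπ.memLp_codiff (m + 1)))
    (Submodule.sub_mem _ hp hp') (Submodule.sub_mem _ hq hq') (Submodule.sub_mem _ hr' hr'') ha''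
    (diam_mul_norm_le hb (bary T) c hr hball hσ (by omega) ha'') hK0
  rw [← enr_sub] at b0 b1 b2
  have hAe : Admissible T (enr T p q r a - enr T p' q' r' a') := hAν.sub hAπ
  have hEd := hAν.weakD_sub hT hAπ
  have hEc := hAν.codiff_sub hT (m + 1) hAπ
  have hd : l2norm T (weakD T ω - weakD T (enr T p' q' r' a')) =
      l2norm T (weakD T (ω - enr T p' q' r' a')) := (eLpNorm_congr_ae hAd).symm
  have hc : l2norm T (codiff (m + 1) T ω - codiff (m + 1) T (enr T p' q' r' a')) =
      l2norm T (codiff (m + 1) T (ω - enr T p' q' r' a')) := (eLpNorm_congr_ae hAc).symm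
  rw [hd, hc] at b0 b1 b2
  set M := l2norm T (ω - enr T p' q' r' a') with hM
  set G := l2norm T (weakD T (ω - enr T p' q' r' a')) with hG
  set F := l2norm T (codiff (m + 1) T (ω - enr T p' q' r' a')) with hF
  have tM : M ≠ ⊤ := hA.memLp.eLpNorm_ne_top
  have tG : G ≠ ⊤ := hA.hasWeakD.memLp.eLpNorm_ne_top
  have tF : F ≠ ⊤ := (hA.memLp_codiff (m + 1)).eLpNorm_ne_top
  have hS0 : 0 ≤ stabConst n (wedgeConst n σ) := stabConst_nonneg hK0
  have conv : ∀ N : ℝ≥0∞, N ≠ ⊤ → N.toReal ≤ stabConst n (wedgeConst n σ) *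
      max 1 (Metric.diam T) * (M.toReal + G.toReal + F.toReal) →
      N ≤ ENNReal.ofReal (stabConst n (wedgeConst n σ)) * max 1 (Metric.ediam T) *
        (M + G + F) := by
    intro N hN hle
    have e1 : ENNReal.ofReal (max 1 (Metric.diam T)) = max 1 (Metric.ediam T) := by
      rw [ENNReal.ofReal_max, ENNReal.ofReal_one, Metric.diam,
        ENNReal.ofReal_toReal hb.ediam_ne_top]
    have e2 : ENNReal.ofReal (M.toReal + G.toReal + F.toReal) = M + G + F := by
      rw [← ENNReal.toReal_add tM tG, ← ENNReal.toReal_add (ENNReal.add_ne_top.2 ⟨tM, tG⟩) tF,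
        ENNReal.ofReal_toReal (ENNReal.add_ne_top.2 ⟨ENNReal.add_ne_top.2 ⟨tM, tG⟩, tF⟩)]
    rw [← ENNReal.ofReal_toReal hN, ← e1, ← e2, ← ENNReal.ofReal_mul hS0,
      ← ENNReal.ofReal_mul (by positivity)]
    exact ENNReal.ofReal_le_ofReal hle
  have b0' := conv _ hAe.memLp.eLpNorm_ne_top b0
  have b1' := conv _ hAe.hasWeakD.memLp.eLpNorm_ne_top b1
  have b2' := conv _ (hAe.memLp_codiff (m + 1)).eLpNorm_ne_top b2
  -- The summand 1 in `cellConst` pays for the error of π itself, the summand `stabConst` for ν - π.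
  have fin : ∀ N E : ℝ≥0∞, N ≤ M + G + F →
      E ≤ ENNReal.ofReal (stabConst n (wedgeConst n σ)) * max 1 (Metric.ediam T) * (M + G + F) →
      N + E ≤ ENNReal.ofReal (cellConst n σ) * max 1 (Metric.ediam T) * (M + G + F) := by
    intro N E hN hE
    rw [cellConst, ENNReal.ofReal_add zero_le_one hS0, ENNReal.ofReal_one, add_mul, add_mul]
    refine add_le_add (hN.trans ?_) hE
    rw [one_mul]
    exact le_mul_of_one_le_left zero_le (le_max_left _ _)
  intro B
  refine ⟨(l2norm_sub_le hA.memLp hAe.memLp ?_).trans (fin _ _ ?_ b0'),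
    (l2norm_sub_le hA.hasWeakD.memLp hAe.hasWeakD.memLp ?_).trans (fin _ _ ?_ b1'),
    (l2norm_sub_le (hA.memLp_codiff (m + 1)) (hAe.memLp_codiff (m + 1)) ?_).trans (fin _ _ ?_ b2')⟩
  · exact Filter.Eventually.of_forall fun x => by simp
  · rw [add_assoc]; exact le_self_add
  · filter_upwards [hAd, hEd] with x h1 h2
    simp only [Pi.sub_apply] at h1 h2 ⊢
    rw [h1, h2]; abel
  · rw [add_right_comm]; exact le_add_self
  · filter_upwards [hAc, hEc] with x h1 h2
    simp only [Pi.sub_apply] at h1 h2 ⊢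
    rw [h1, h2]; abel
  · exact le_add_self

end CellInterpolant

/-! ### Summation over the cells -/

namespace Subdivision

variable {n : ℕ} {Ω : Set (Pt n)}

theorem _root_.FEForms.isBounded_cell (T : Affine.Simplex ℝ (Pt n) n) :
    Bornology.IsBounded (cell T) :=
  ((Set.finite_range T.points).isCompact_convexHull ℝ).isBounded.subset interior_subset

theorem glue_apply (G : Subdivision Ω) (f : Affine.Simplex ℝ (Pt n) n → Pt n → Form n)
    {T : Affine.Simplex ℝ (Pt n) n} (hT : T ∈ G.cells) {x : Pt n} (hx : x ∈ cell T) :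
    G.glue f x = f T x := by
  rw [glue, Finset.sum_apply, Finset.sum_eq_single T]
  · exact Set.indicator_of_mem hx _
  · intro S hS hne
    exact Set.indicator_of_notMem
      (fun h => Set.disjoint_left.1 (G.disjoint_cell S hS T hT hne) h hx) _
  · exact fun h => absurd hT h

/-- Points of the domain missed by the open cells lie on the frontiers of the closed ones, and the
frontier of a convex set is null. -/
theorem restrict_eq (G : Subdivision Ω) : (volume : Measure (Pt n)).restrict Ω =
    volume.restrict (⋃ T ∈ G.cells, cell T) := by
  refine Measure.restrict_congr_set (Filter.EventuallyLE.antisymm ?_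
    (LE.le.eventuallyLE (Set.iUnion₂_subset G.cell_subset)))
  rw [ae_le_set]
  refine measure_mono_null (t := ⋃ T ∈ G.cells, frontier (closedCell T)) ?_ ?_
  · rintro x ⟨hx, hx'⟩
    have h := subset_closure hx
    rw [G.closure_eq] at h
    simp only [Set.mem_iUnion, exists_prop] at h hx' ⊢
    obtain ⟨T, hT, hxT⟩ := h
    exact ⟨T, hT, subset_closure hxT, fun hi => hx' ⟨T, hT, hi⟩⟩
  · refine le_antisymm ((measure_biUnion_finset_le _ _).trans
      (Finset.sum_eq_zero fun T _ => ?_).le) bot_le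
    exact (convex_convexHull ℝ _).addHaar_frontier volume

/-- Additivity over cells is that of the lower integral over disjoint measurable sets, so no
measurability of `f` is needed. -/
theorem l2norm_sq (G : Subdivision Ω) (f : Pt n → Form n) :
    l2norm Ω f ^ 2 = ∑ T ∈ G.cells, l2norm (cell T) f ^ 2 := by
  have h : ∀ μ : Measure (Pt n), eLpNorm f 2 μ ^ 2 = ∫⁻ x, ‖f x‖ₑ ^ (2 : ℝ) ∂μ := fun μ => by
    have := eLpNorm_nnreal_pow_eq_lintegral (f := f) (μ := μ) (p := 2) (by norm_num)
    simpa using this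
  simp only [l2norm, h]
  rw [G.restrict_eq, lintegral_biUnion_finset]
  · exact fun S hS T hT hne => G.disjoint_cell S hS T hT hne
  · exact fun T _ => isOpen_interior.measurableSet

/-- Each term is compared with the largest of the three, which is why the factor is 9. -/
theorem _root_.FEForms.sq_add_add_le (x y z : ℝ≥0∞) :
    (x + y + z) ^ 2 ≤ 9 * (x ^ 2 + y ^ 2 + z ^ 2) := by
  have key : ∀ w, x ≤ w → y ≤ w → z ≤ w → (x + y + z) ^ 2 ≤ 9 * w ^ 2 := fun w hx hy hz =>
    calc (x + y + z) ^ 2 ≤ (w + w + w) ^ 2 := by gcongr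
      _ = 9 * w ^ 2 := by ring
  rcases le_total x y with h1 | h1
  · rcases le_total y z with h2 | h2
    · exact (key z (h1.trans h2) h2 le_rfl).trans (by gcongr; exact le_add_self)
    · exact (key y h1 le_rfl h2).trans (by gcongr; rw [add_right_comm]; exact le_add_self)
  · rcases le_total x z with h2 | h2
    · exact (key z h2 (h1.trans h2) le_rfl).trans (by gcongr; exact le_add_self)
    · exact (key x le_rfl h1 h2).trans (by gcongr; rw [add_assoc]; exact le_self_add)

/-- The cellwise bounds are summed in squares; the factor 3 is the price of passing from a sum of
norms to a sum of squares on each cell. -/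
theorem l2norm_le_of_forall_cell (G : Subdivision Ω) {c : ℝ≥0∞} {f u v w : Pt n → Form n}
    (h : ∀ T ∈ G.cells, l2norm (cell T) f ≤
      c * (l2norm (cell T) u + l2norm (cell T) v + l2norm (cell T) w)) :
    l2norm Ω f ≤ 3 * c * (l2norm Ω u + l2norm Ω v + l2norm Ω w) := by
  refine (ENNReal.pow_le_pow_left_iff two_ne_zero).1 ?_
  calc l2norm Ω f ^ 2 = ∑ T ∈ G.cells, l2norm (cell T) f ^ 2 := G.l2norm_sq f
    _ ≤ ∑ T ∈ G.cells, c ^ 2 * (9 * (l2norm (cell T) u ^ 2 + l2norm (cell T) v ^ 2 +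
          l2norm (cell T) w ^ 2)) := by
        refine Finset.sum_le_sum fun T hT => ?_
        calc _ ≤ (c * (l2norm (cell T) u + l2norm (cell T) v + l2norm (cell T) w)) ^ 2 := by
              gcongr; exact h T hT
          _ ≤ _ := by rw [mul_pow]; gcongr; exact sq_add_add_le _ _ _
    _ = c ^ 2 * (9 * (l2norm Ω u ^ 2 + l2norm Ω v ^ 2 + l2norm Ω w ^ 2)) := by
        rw [G.l2norm_sq u, G.l2norm_sq v, G.l2norm_sq w, ← Finset.mul_sum, ← Finset.mul_sum,
          Finset.sum_add_distrib, Finset.sum_add_distrib]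
    _ ≤ c ^ 2 * (9 * (l2norm Ω u + l2norm Ω v + l2norm Ω w) ^ 2) := by
        gcongr
        calc l2norm Ω u ^ 2 + l2norm Ω v ^ 2 + l2norm Ω w ^ 2
            ≤ l2norm Ω u ^ 2 + l2norm Ω v ^ 2 + l2norm Ω w ^ 2 + 2 * (l2norm Ω u * l2norm Ω v +
              l2norm Ω u * l2norm Ω w + l2norm Ω v * l2norm Ω w) := le_self_add
          _ = _ := by ring
    _ = _ := by ring

theorem meshSize_ne_top (G : Subdivision Ω) : G.meshSize ≠ ⊤ := by
  rw [meshSize, ← Finset.sup_eq_iSup]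
  refine ((Finset.sup_lt_iff ENNReal.zero_lt_top).2 fun T _ => ?_).ne
  exact (isBounded_cell T).ediam_ne_top.lt_top

theorem ediam_le_meshSize (G : Subdivision Ω) {T : Affine.Simplex ℝ (Pt n) n}
    (hT : T ∈ G.cells) : Metric.ediam (cell T) ≤ G.meshSize :=
  le_iSup₂ (f := fun T (_ : T ∈ G.cells) => Metric.ediam (cell T)) T hT

end Subdivision

theorem l2norm_congr {n : ℕ} {T : Set (Pt n)} {f g : Pt n → Form n}
    (h : f =ᵐ[volume.restrict T] g) : l2norm T f = l2norm T g := eLpNorm_congr_ae h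

theorem eqOn_ae {n : ℕ} {T : Set (Pt n)} (hT : IsOpen T) {f g : Pt n → Form n}
    (h : Set.EqOn f g T) : f =ᵐ[volume.restrict T] g :=
  (ae_restrict_iff' hT.measurableSet).2 (Filter.Eventually.of_forall h)

end FEForms

end

/-! ### The global quasi-optimality estimate -/

theorem mainTheorem2 (n k : ℕ) (hk : 1 ≤ k) (hkn : k + 1 ≤ n) (σ : ℝ) :
    ∃ C : ℝ≥0, ∀ Ω : Set (Pt n), IsOpen Ω →
      ∀ G : Subdivision Ω, G.ShapeRegular σ →
      ∀ ω : Pt n → Form n, MemH k Ω ω → MemHStarZero k Ω ω →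
        (∀ T ∈ G.cells, ∃! ν, IsCellInterpolant k (cell T) ω ν) ∧
        l2norm Ω (ω - G.interp k ω)
            + l2norm Ω (weakD Ω ω - G.dh (G.interp k ω))
            + l2norm Ω (codiff k Ω ω - G.codiffh k (G.interp k ω))
          ≤ C * max 1 G.meshSize *
            ⨅ μ ∈ G.enrichedSpace k,
              (l2norm Ω (ω - μ) + l2norm Ω (G.dh (ω - μ)) + l2norm Ω (G.codiffh k (ω - μ))) := by
  obtain ⟨m, rfl⟩ : ∃ m, k = m + 1 := ⟨k - 1, by omega⟩
  -- 9 = 3 · 3: three norms on the left, each losing a factor 3 in `l2norm_le_of_forall_cell`.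
  refine ⟨9 * (cellConst n σ).toNNReal, fun Ω hΩ G hG ω hωH hω0 => ?_⟩
  have hω : Admissible Ω ω := by
    obtain ⟨h1, η, h2, h3⟩ := hωH
    obtain ⟨-, ζ, h4, h5⟩ := hω0.1.2
    exact ⟨h1.1, ⟨η, h2.1, h3⟩, ⟨ζ, h4.1, h5⟩⟩
  have ho : ∀ T, IsOpen (cell (n := n) T) := fun T => isOpen_interior
  have hb : ∀ T, Bornology.IsBounded (cell (n := n) T) := isBounded_cell
  have hωT : ∀ T ∈ G.cells, Admissible (cell T) ω := fun T hT => hω.mono hΩ (G.cell_subset T hT)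
  have hne : ∀ T ∈ G.cells, (cell T).Nonempty := fun T hT => by
    obtain ⟨c, r, hr, hball, -⟩ := hG T hT
    exact ⟨c, hball (Metric.mem_ball_self hr)⟩
  refine ⟨fun T hT => existsUnique_isCellInterpolant (ho T) (hne T hT) (hb T) hkn (hωT T hT), ?_⟩
  have hC : (1 : ℝ≥0∞) ≤ ENNReal.ofReal (cellConst n σ) :=
    ENNReal.one_le_ofReal.2 (one_le_cellConst n σ)
  -- Multiplication by a nonzero finite constant commutes with the infimum in `ℝ≥0∞`, so a single
  -- competitor can be fixed.
  have hne0 : ((9 * (cellConst n σ).toNNReal : ℝ≥0) : ℝ≥0∞) * max 1 G.meshSize ≠ 0 := by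
    refine mul_ne_zero ?_ (zero_lt_one.trans_le (le_max_left _ _)).ne'
    rw [ENNReal.coe_mul]
    exact mul_ne_zero (by norm_num) (zero_lt_one.trans_le hC).ne'
  have hneT : ((9 * (cellConst n σ).toNNReal : ℝ≥0) : ℝ≥0∞) * max 1 G.meshSize ≠ ⊤ :=
    ENNReal.mul_ne_top ENNReal.coe_ne_top (by simp [G.meshSize_ne_top])
  simp only [ENNReal.mul_iInf_of_ne hne0 hneT]
  refine le_iInf₂ fun μ hμ => ?_
  obtain ⟨p, hp, rfl⟩ := hμ
  have key : ∀ T ∈ G.cells,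
      let B := ENNReal.ofReal (cellConst n σ) * max 1 G.meshSize *
        (l2norm (cell T) (ω - G.glue p) + l2norm (cell T) (G.dh (ω - G.glue p)) +
          l2norm (cell T) (G.codiffh (m + 1) (ω - G.glue p)))
      l2norm (cell T) (ω - G.interp (m + 1) ω) ≤ B ∧
      l2norm (cell T) (weakD Ω ω - G.dh (G.interp (m + 1) ω)) ≤ B ∧
      l2norm (cell T) (codiff (m + 1) Ω ω - G.codiffh (m + 1) (G.interp (m + 1) ω)) ≤ B := by
    intro T hT
    obtain ⟨c, r, hr, hball, hσ⟩ := hG T hT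
    have hsub := G.cell_subset T hT
    obtain ⟨b0, b1, b2⟩ := (isCellInterpolant_cellInterp (ho T) (hne T hT) (hb T) hkn
      (hωT T hT)).quasi_optimal (ho T) (hb T) hkn hr hball hσ (hωT T hT) (hp T hT)
    have ei : Set.EqOn (G.interp (m + 1) ω) (cellInterp (m + 1) (cell T) ω) (cell T) :=
      fun x hx => G.glue_apply _ hT hx
    have ep : Set.EqOn (ω - G.glue p) (ω - p T) (cell T) := fun x hx => by
      simp only [Pi.sub_apply, G.glue_apply p hT hx]
    -- On a cell the piecewise operators see only the values there, so glued forms are traded for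
    -- their local pieces.
    have ed : ∀ u v : Pt n → Form n, Set.EqOn u v (cell T) →
        Set.EqOn (G.dh u) (weakD (cell T) v) (cell T) := fun u v h x hx => by
      rw [Subdivision.dh, G.glue_apply _ hT hx, weakD_congr (ho T) h]
    have ec : ∀ u v : Pt n → Form n, Set.EqOn u v (cell T) →
        Set.EqOn (G.codiffh (m + 1) u) (codiff (m + 1) (cell T) v) (cell T) := fun u v h x hx => by
      rw [Subdivision.codiffh, G.glue_apply _ hT hx, codiff_congr (ho T) _ h]
    rw [← l2norm_congr (eqOn_ae (ho T) ep), ← l2norm_congr (eqOn_ae (ho T) (ed _ _ ep)),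
      ← l2norm_congr (eqOn_ae (ho T) (ec _ _ ep))] at b0 b1 b2
    have hle : ENNReal.ofReal (cellConst n σ) * max 1 (Metric.ediam (cell T)) *
        (l2norm (cell T) (ω - G.glue p) + l2norm (cell T) (G.dh (ω - G.glue p)) +
          l2norm (cell T) (G.codiffh (m + 1) (ω - G.glue p))) ≤
        ENNReal.ofReal (cellConst n σ) * max 1 G.meshSize *
        (l2norm (cell T) (ω - G.glue p) + l2norm (cell T) (G.dh (ω - G.glue p)) +
          l2norm (cell T) (G.codiffh (m + 1) (ω - G.glue p))) := by
      gcongr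
      exact G.ediam_le_meshSize hT
    refine ⟨le_trans (le_of_eq ?_) (b0.trans hle), le_trans (le_of_eq ?_) (b1.trans hle),
      le_trans (le_of_eq ?_) (b2.trans hle)⟩
    · exact l2norm_congr (Filter.EventuallyEq.rfl.sub (eqOn_ae (ho T) ei))
    -- The global weak derivative of ω restricts to its weak derivative on the cell, up to a null
    -- set.
    · exact l2norm_congr ((hω.weakD_mono hΩ (ho T) hsub).symm.sub (eqOn_ae (ho T) (ed _ _ ei)))
    · exact l2norm_congr ((hω.codiff_mono hΩ (ho T) hsub (m + 1)).symm.sub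
        (eqOn_ae (ho T) (ec _ _ ei)))
  refine (add_le_add (add_le_add (G.l2norm_le_of_forall_cell fun T hT => (key T hT).1)
    (G.l2norm_le_of_forall_cell fun T hT => (key T hT).2.1))
    (G.l2norm_le_of_forall_cell fun T hT => (key T hT).2.2)).trans (le_of_eq ?_)
  rw [ENNReal.coe_mul, ENNReal.ofReal]
  push_cast
  ring
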